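/- Let $X=\{X_s\}_{s\ge 0}$ be a Lévy process on $\mathbf{R}$ with characteristic exponent $\Psi$, normalized so that $\mathrm{E}\exp(i\xi X_s)=\exp(-s\Psi(\xi))$ for all $s\ge 0$ and $\xi\in\mathbf{R}$. Assume Dalang's condition $$\int_{-\infty}^\infty\frac{d\xi}{\beta+2\,\mathrm{Re}\,\Psi(\xi)}<\infty\quad\text{for one, and hence all, }\beta>0,$$ and $$\lim_{|\xi|\to\infty}\frac{\mathrm{Re}\,\Psi(\xi)}{\log|\xi|}=\infty .$$ Then $X$ has jointly measurable transition densities $p_s(x,y)$ with respect to Lebesgue measure, that is, $y\mapsto p_s(x,y)$ is a probability density function of $x+X_s$ for every $s>0$ and $x\in\mathbf{R}$. Moreover, let $W$ be a white noise on $\mathbf{R}_+\times\mathbf{R}$ with control measure $ds\times dy$, that is, a centered Gaussian process indexed by the Borel sets of finite measure, with $\mathrm{Cov}(W(A),W(B))=|A\cap B|$. Then, for all $t,\alpha>0$ and every choice of such densities, the process $$S_\alpha(t,x):=\int_t^\infty\int_{\mathbf{R}} e^{-\alpha s/2}\,p_s(x,y)\,W(dy\,ds),\qquad x\in\mathbf{R},$$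 is well defined as a family of Wiener integrals [the integrands are in $L^2(ds\times dy)$], and it has a modification $\{\widetilde S(x)\}_{x\in\mathbf{R}}$ such that every sample path $x\mapsto\widetilde S(x)$ is in $C^\infty(\mathbf{R})$. -/

import Mathlib

open MeasureTheory ProbabilityTheory Filter
open scoped Topology NNReal ENNReal

noncomputable section

/-- A real-valued Lévy process: it starts at `0`, has independent and stationary increments, and is
continuous in probability (every process with càdlàg paths and stationary increments is). -/
structure IsLevyProcess {Ω : Type*} [MeasurableSpace Ω] (X : ℝ≥0 → Ω → ℝ) (P : Measure Ω) :
    Prop where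
  measurable : ∀ t, Measurable (X t)
  zero : ∀ᵐ ω ∂P, X 0 ω = 0
  indep : HasIndepIncrements X P
  stationary : ∀ s t, s ≤ t → IdentDistrib (fun ω => X t ω - X s ω) (X (t - s)) P P
  continuousInProbability : ∀ s, TendstoInMeasure P X (𝓝 s) (X s)

/-- `Ψ` is the characteristic exponent of `X`: `E exp(i ξ X_t) = exp(-t Ψ(ξ))`. -/
def IsCharExponent {Ω : Type*} [MeasurableSpace Ω] (X : ℝ≥0 → Ω → ℝ) (P : Measure Ω)
    (Ψ : ℝ → ℂ) : Prop :=
  ∀ (t : ℝ≥0) (ξ : ℝ),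
    ∫ ω, Complex.exp (Complex.I * (ξ : ℂ) * (X t ω : ℂ)) ∂P
      = Complex.exp (-((t : ℝ) : ℂ) * Ψ ξ)

/-- Dalang's condition: `∫ dξ / (α + 2 Re Ψ(ξ)) < ∞` for some `α > 0`
(equivalently for all `α > 0`, since `Re Ψ ≥ 0`). -/
def DalangCondition (Ψ : ℝ → ℂ) : Prop :=
  ∃ α : ℝ, 0 < α ∧ Integrable (fun ξ : ℝ => 1 / (α + 2 * (Ψ ξ).re))

/-- `p s x y` (for `s > 0`) are transition densities, with respect to Lebesgue measure, of the
Markov process `x + X_s`, jointly measurable in `(s, x, y)`. Values at `s ≤ 0` play no role. -/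
structure IsTransitionDensity {Ω : Type*} [MeasurableSpace Ω] (X : ℝ≥0 → Ω → ℝ) (P : Measure Ω)
    (p : ℝ → ℝ → ℝ → ℝ) : Prop where
  measurable : Measurable (fun q : ℝ × ℝ × ℝ => p q.1 q.2.1 q.2.2)
  nonneg : ∀ s x y, 0 < s → 0 ≤ p s x y
  density : ∀ (s : ℝ≥0) (x : ℝ), 0 < s →
    P.map (fun ω => x + X s ω) = volume.withDensity (fun y => ENNReal.ofReal (p s x y))

/-- White noise with control measure `m`: a centered Gaussian process indexed by the measurable
sets of finite `m`-measure, with `Cov(W(A), W(B)) = m(A ∩ B)`. Values of `W` at other sets play no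
role. -/
structure IsWhiteNoise {E : Type*} [MeasurableSpace E] (m : Measure E)
    {Ω : Type*} [MeasurableSpace Ω] (W : Set E → Ω → ℝ) (P : Measure Ω) : Prop where
  gaussian : IsGaussianProcess (fun A : {A : Set E // MeasurableSet A ∧ m A < ∞} => W A.1) P
  mean : ∀ A, MeasurableSet A → m A < ∞ → ∫ ω, W A ω ∂P = 0
  cov : ∀ A B, MeasurableSet A → m A < ∞ → MeasurableSet B → m B < ∞ →
    ∫ ω, W A ω * W B ω ∂P = (m (A ∩ B)).toReal

/-- The stochastic integral `∫ f dW = ∑ c W(f = c)` of a simple function. -/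
def simpleWienerIntegral {E : Type*} [MeasurableSpace E] {Ω : Type*}
    (W : Set E → Ω → ℝ) (f : SimpleFunc E ℝ) (ω : Ω) : ℝ :=
  ∑ c ∈ f.range, c * W (f ⁻¹' {c}) ω

/-- `Y` is (a version of) the Wiener integral `∫ f dW` of `f ∈ L²(m)`: the `L²(P)`-limit of the
integrals of simple functions in `L²(m)` that converge to `f` in `L²(m)`. -/
structure IsWienerIntegral {E : Type*} [MeasurableSpace E] (m : Measure E)
    {Ω : Type*} [MeasurableSpace Ω] (W : Set E → Ω → ℝ) (P : Measure Ω)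
    (f : E → ℝ) (Y : Ω → ℝ) : Prop where
  memLp_integrand : MemLp f 2 m
  memLp : MemLp Y 2 P
  approx : ∃ g : ℕ → SimpleFunc E ℝ,
    (∀ n, MemLp (g n) 2 m) ∧
    Tendsto (fun n => eLpNorm (fun q => g n q - f q) 2 m) atTop (𝓝 0) ∧
    Tendsto (fun n => eLpNorm (fun ω => simpleWienerIntegral W (g n) ω - Y ω) 2 P) atTop (𝓝 0)

/-- The measure `ds × dy` on `ℝ₊ × ℝ`, as a measure on `ℝ × ℝ`. -/
def spaceTimeMeasure : Measure (ℝ × ℝ) := (volume.restrict (Set.Ici (0 : ℝ))).prod volume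

/-- The integrand `(s, y) ↦ 1_{s > t} exp(-α s / 2) p_s(x, y)` of `S_α(t, x)`. -/
def tailIntegrand (p : ℝ → ℝ → ℝ → ℝ) (α t x : ℝ) (q : ℝ × ℝ) : ℝ :=
  (Set.Ioi t).indicator (fun s => Real.exp (-α * s / 2) * p s x q.2) q.1

/-- `S x = S_α(t, x) = ∫_t^∞ ∫ exp(-α s / 2) p_s(x, y) W(dy ds)` for every `x`. -/
def IsTailField {Ω : Type*} [MeasurableSpace Ω] (W : Set (ℝ × ℝ) → Ω → ℝ) (P : Measure Ω)
    (p : ℝ → ℝ → ℝ → ℝ) (α t : ℝ) (S : ℝ → Ω → ℝ) : Prop :=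
  ∀ x, IsWienerIntegral spaceTimeMeasure W P (tailIntegrand p α t x) (S x)

/-- `S'` is a modification of the process `S`. -/
def IsModification {Ω : Type*} [MeasurableSpace Ω] (P : Measure Ω) (S' S : ℝ → Ω → ℝ) : Prop :=
  (∀ x, Measurable (S' x)) ∧ ∀ x, S' x =ᵐ[P] S x

end

/-! By the Itô isometry and Plancherel, the covariance of the tail field is
$\int_t^\infty\int(2\pi)^{-1}e^{-\alpha s-2s\,\mathrm{Re}\Psi(\xi)}\cos((x-x')\xi)\,d\xi\,ds$
(`IsTransitionDensity.integral_tailIntegrand_mul`). This is also the Gram matrix of the curve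
$x\mapsto w(s,\xi)e^{ix\xi}$, with $w$ = `spectralAmplitude`. Since $\mathrm{Re}\,\Psi$ outgrows the
logarithm, $e^{-t\,\mathrm{Re}\Psi}$ beats every power of $\xi$. All moments of $w^2$ are thus
finite and the curve is infinitely differentiable in $L^2$ (`exists_smooth_spectral_curve`). Equal
Gram matrices give a bounded linear map from the spectral curve to $x\mapsto S(x)\in L^2(P)$
(`exists_clm_of_inner_eq`), so the field is smooth in mean square.

Smoothness in mean square becomes smoothness of paths in `exists_smooth_version`. Projecting to
finite-dimensional subspaces gives processes with smooth paths. Along a fast subsequence, the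
expected $W^{1,1}$ norms of their increments, on every compact interval and for every derivative,
are summable. Almost surely the telescoping series can then be differentiated term by term.

The densities come from Fourier inversion, because $e^{-s\Psi}$ is integrable for $s>0$. Any other
choice agrees with them for almost every $y$, which suffices for all the integrals. -/

/-! ### Smooth curves in $L^2$ and versions with smooth paths -/

/-- A sequence of functions, each the derivative of the previous one, consists of smooth
functions. -/
theorem contDiff_of_hasDerivAt_succ {E : Type*} [NormedAddCommGroup E] [NormedSpace ℝ E]
    {F : ℕ → ℝ → E} (hF : ∀ k x, HasDerivAt (F k) (F (k + 1) x) x) :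
    ContDiff ℝ (⊤ : ℕ∞) (F 0) := by
  have key : ∀ n : ℕ, ∀ k, ContDiff ℝ n (F k) := by
    intro n
    induction n with
    | zero =>
      intro k
      exact contDiff_zero.2 (continuous_iff_continuousAt.2 fun x => (hF k x).continuousAt)
    | succ n ih =>
      intro k
      have hd : deriv (F k) = F (k + 1) := funext fun x => (hF k x).deriv
      rw [Nat.cast_add, Nat.cast_one, contDiff_succ_iff_deriv]
      refine ⟨fun x => (hF k x).differentiableAt, by simp, ?_⟩
      rw [hd]
      exact ih (k + 1)
  exact contDiff_infty.2 fun n => key n 0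

/-- Two families in Hilbert spaces with the same Gram matrix are related by a continuous linear
map. -/
theorem exists_clm_of_inner_eq {ι H H' : Type*} [NormedAddCommGroup H] [InnerProductSpace ℝ H]
    [CompleteSpace H] [NormedAddCommGroup H'] [InnerProductSpace ℝ H'] [CompleteSpace H']
    (e : ι → H) (G : ι → H') (h : ∀ i j, inner ℝ (G i) (G j) = inner ℝ (e i) (e j)) :
    ∃ T : H →L[ℝ] H', ∀ i, T (e i) = G i := by
  classical
  let K : Submodule ℝ H := (Submodule.span ℝ (Set.range e)).topologicalClosure
  have hK : IsClosed (K : Set H) := Submodule.isClosed_topologicalClosure _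
  have : CompleteSpace K := hK.completeSpace_coe
  have hmem : ∀ i, e i ∈ K := fun i =>
    Submodule.le_topologicalClosure _ (Submodule.subset_span ⟨i, rfl⟩)
  let eK : (ι →₀ ℝ) →ₗ[ℝ] K := Finsupp.linearCombination ℝ fun i => (⟨e i, hmem i⟩ : K)
  let gl : (ι →₀ ℝ) →ₗ[ℝ] H' := Finsupp.linearCombination ℝ G
  have heK : ∀ v, (eK v : H) = Finsupp.linearCombination ℝ e v := by
    intro v
    simp [eK, Finsupp.linearCombination_apply, Finsupp.sum]
  -- Equal Gram matrices make formal combinations have equal norms on both sides, so `gl` factors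
  -- through `eK`.
  have hnorm : ∀ v, ‖gl v‖ ≤ 1 * ‖eK v‖ := by
    intro v
    have h2 : ‖gl v‖ ^ 2 = ‖eK v‖ ^ 2 := by
      rw [Submodule.coe_norm, heK, ← real_inner_self_eq_norm_sq, ← real_inner_self_eq_norm_sq]
      simp only [gl, Finsupp.linearCombination_apply, Finsupp.sum, sum_inner, inner_sum,
        real_inner_smul_left, real_inner_smul_right, h]
    rw [one_mul]
    exact (abs_le_of_sq_le_sq' h2.le (norm_nonneg _)).2
  have hdense : DenseRange eK := by
    intro y
    have hy : (y : H) ∈ closure (Submodule.span ℝ (Set.range e) : Set H) := y.2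
    rw [closure_subtype]
    refine closure_mono ?_ hy
    intro z hz
    obtain ⟨v, rfl⟩ := (Finsupp.mem_span_range_iff_exists_finsupp).1 hz
    exact ⟨eK v, ⟨v, rfl⟩, by rw [heK, Finsupp.linearCombination_apply]⟩
  -- The isometry lives only on the closed span `K`; projecting onto `K` first defines it on all of
  -- `H`.
  refine ⟨(gl.extendOfNorm eK).comp K.orthogonalProjectionOnto, fun i => ?_⟩
  have h1 : K.orthogonalProjectionOnto (e i) = eK (Finsupp.single i 1) := by
    have : eK (Finsupp.single i 1) = ⟨e i, hmem i⟩ := by simp [eK]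
    rw [this]
    exact Submodule.orthogonalProjectionOnto_mem_subspace_eq_self (⟨e i, hmem i⟩ : K)
  rw [ContinuousLinearMap.comp_apply, h1, LinearMap.extendOfNorm_eq hdense ⟨1, hnorm⟩]
  simp [gl]

/-- The projections onto the spans of finitely many values of a continuous curve are of finite rank
and converge strongly to the identity on the closed span of the curve. -/
theorem exists_finiteDimensional_approx {H : Type*} [NormedAddCommGroup H]
    [InnerProductSpace ℝ H] [CompleteSpace H] (G : ℕ → ℝ → H)
    (hG : ∀ k x, HasDerivAt (G k) (G (k + 1) x) x) :
    ∃ V : ℕ → Submodule ℝ H, ∃ _ : ∀ n, FiniteDimensional ℝ (V n),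
      ∀ k x, Tendsto (fun n => (V n).starProjection (G k x)) atTop (𝓝 (G k x)) := by
  let q : ℕ → ℝ := TopologicalSpace.denseSeq ℝ
  let V : ℕ → Submodule ℝ H := fun n => Submodule.span ℝ ((fun i => G 0 (q i)) '' Set.Iio n)
  have hV : ∀ n, FiniteDimensional ℝ (V n) := fun n =>
    FiniteDimensional.span_of_finite ℝ ((Set.finite_Iio n).image _)
  have hmono : Monotone V := fun m n hmn =>
    Submodule.span_mono (Set.image_mono (Set.Iio_subset_Iio hmn))
  let K : Submodule ℝ H := (⨆ n, V n).topologicalClosure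
  have hK : IsClosed (K : Set H) := Submodule.isClosed_topologicalClosure _
  have : CompleteSpace K := hK.completeSpace_coe
  have hmem : ∀ k x, G k x ∈ K := by
    intro k
    induction k with
    | zero =>
      have hcont : Continuous (G 0) :=
        continuous_iff_continuousAt.2 fun x => (hG 0 x).continuousAt
      intro x
      have hd : Dense (Set.range q) := TopologicalSpace.denseRange_denseSeq ℝ
      have hx : G 0 x ∈ closure (G 0 '' Set.range q) :=
        image_closure_subset_closure_image hcont ⟨x, hd x, rfl⟩
      refine closure_minimal ?_ hK hx
      rintro _ ⟨_, ⟨i, rfl⟩, rfl⟩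
      exact Submodule.le_topologicalClosure _ (Submodule.mem_iSup_of_mem (i + 1)
        (Submodule.subset_span ⟨i, by simp, rfl⟩))
    | succ k ih =>
      intro x
      -- Derivatives are limits of difference quotients, so they stay in the closed span of the
      -- values of `G 0`.
      refine hK.mem_of_tendsto (hasDerivAt_iff_tendsto_slope.1 (hG k x)) (Eventually.of_forall ?_)
      intro y
      exact K.smul_mem _ (K.sub_mem (ih y) (ih x))
  refine ⟨V, hV, fun k x => ?_⟩
  have := Submodule.starProjection_tendsto_closure_iSup V hmono (G k x)
  rwa [(Submodule.starProjection_eq_self_iff).2 (hmem k x)] at this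

/-- A smooth curve in a finite-dimensional space of random variables has a version that is smooth
in the parameter for every sample point. -/
theorem exists_finiteRank_version {Ω : Type*} [MeasurableSpace Ω] {P : Measure Ω}
    (V : Submodule ℝ (Lp ℝ 2 P)) [FiniteDimensional ℝ V] (G : ℕ → ℝ → Lp ℝ 2 P)
    (hG : ∀ k x, HasDerivAt (G k) (G (k + 1) x) x) :
    ∃ g : ℕ → ℝ → Ω → ℝ, (∀ k, Measurable (Function.uncurry (g k))) ∧
      (∀ k x ω, HasDerivAt (fun y => g k y ω) (g (k + 1) x ω) x) ∧
      ∀ k x, g k x =ᵐ[P] V.starProjection (G k x) := by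
  let b := Module.finBasis ℝ V
  let c : Fin (Module.finrank ℝ V) → Lp ℝ 2 P →L[ℝ] ℝ := fun i =>
    (LinearMap.toContinuousLinearMap (b.coord i)).comp V.orthogonalProjectionOnto
  have hc : ∀ i k x, HasDerivAt (fun y => c i (G k y)) (c i (G (k + 1) x)) x := fun i k x =>
    (c i).hasFDerivAt.comp_hasDerivAt x (hG k x)
  -- Fixing one representative of each basis vector leaves all dependence on `x` in finitely many
  -- smooth coordinates, hence smoothness for every `ω`.
  refine ⟨fun k x ω => ∑ i, c i (G k x) * ((b i : Lp ℝ 2 P) : Ω → ℝ) ω, ?_, ?_, ?_⟩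
  · intro k
    refine Finset.measurable_fun_sum _ fun i _ => ?_
    have h1 : Measurable fun x => c i (G k x) :=
      (continuous_iff_continuousAt.2 fun x => (hc i k x).continuousAt).measurable
    exact (h1.comp measurable_fst).mul
      ((Lp.stronglyMeasurable (b i : Lp ℝ 2 P)).measurable.comp measurable_snd)
  · intro k x ω
    exact HasDerivAt.fun_sum fun i _ => (hc i k x).mul_const _
  · intro k x
    have h1 : V.starProjection (G k x) = ∑ i, c i (G k x) • (b i : Lp ℝ 2 P) := by
      have := congrArg (Subtype.val) (b.sum_repr (V.orthogonalProjectionOnto (G k x)))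
      rw [Submodule.starProjection_apply, ← this, Submodule.coe_sum]
      rfl
    rw [h1]
    have h2 : ∀ᵐ ω ∂P, ∀ i, (c i (G k x) • (b i : Lp ℝ 2 P) : Lp ℝ 2 P) ω
        = c i (G k x) * ((b i : Lp ℝ 2 P) : Ω → ℝ) ω := by
      rw [ae_all_iff]
      intro i
      filter_upwards [Lp.coeFn_smul (c i (G k x)) (b i : Lp ℝ 2 P)] with ω hω
      rw [hω]; rfl
    filter_upwards [h2, Lp.coeFn_finsetSum Finset.univ fun i => c i (G k x) • (b i : Lp ℝ 2 P)]
      with ω hω hs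
    rw [hs]
    simp [hω]

/-- The one-dimensional Sobolev bound, from the fundamental theorem of calculus. It turns integral
bounds, whose expectations are computable by Tonelli, into uniform ones. -/
theorem enorm_le_enorm_zero_add_lintegral {f f' : ℝ → ℝ} (hf : ∀ x, HasDerivAt f (f' x) x)
    (hf' : Continuous f') {R x : ℝ} (hx : |x| ≤ R) :
    ‖f x‖ₑ ≤ ‖f 0‖ₑ + ∫⁻ u in Set.Icc (-R) R, ‖f' u‖ₑ := by
  have hd : deriv f = f' := funext fun x => (hf x).deriv
  have hC : ContDiff ℝ 1 f := contDiff_one_iff_deriv.2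
    ⟨fun x => (hf x).differentiableAt, by rwa [hd]⟩
  have hle : ∀ a b : ℝ, a ≤ b → -R ≤ a → b ≤ R →
      ‖f b - f a‖ₑ ≤ ∫⁻ u in Set.Icc (-R) R, ‖f' u‖ₑ := by
    intro a b hab ha hb
    have h := enorm_sub_le_lintegral_deriv_of_contDiffOn_Icc (hC.contDiffOn (s := Set.Icc a b)) hab
    rw [hd] at h
    exact h.trans (lintegral_mono_set (Set.Icc_subset_Icc ha hb))
  have hx' := abs_le.1 hx
  have h0 : ‖f x - f 0‖ₑ ≤ ∫⁻ u in Set.Icc (-R) R, ‖f' u‖ₑ := by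
    rcases le_total 0 x with h | h
    · exact hle 0 x h (by linarith) hx'.2
    · rw [enorm_sub_rev]
      exact hle x 0 h hx'.1 (by linarith)
  calc ‖f x‖ₑ = ‖f 0 + (f x - f 0)‖ₑ := by rw [add_sub_cancel]
    _ ≤ ‖f 0‖ₑ + ‖f x - f 0‖ₑ := enorm_add_le _ _
    _ ≤ _ := by gcongr

/-- A series of smooth functions whose `W^{1,1}` norms on compact intervals are summable, as are
those of all derivatives, can be differentiated term by term. -/
theorem hasDerivAt_tsum_of_tsum_lintegral_ne_top {b : ℕ → ℕ → ℝ → ℝ}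
    (hb : ∀ j k x, HasDerivAt (b j k) (b j (k + 1) x) x)
    (hsum : ∀ k R : ℕ, ∑' j, (‖b j k 0‖ₑ + ∫⁻ u in Set.Icc (-R : ℝ) R, ‖b j (k + 1) u‖ₑ) ≠ ∞) :
    (∀ k x, Summable fun j => b j k x) ∧
      ∀ k x, HasDerivAt (fun y => ∑' j, b j k y) (∑' j, b j (k + 1) x) x := by
  have hcont : ∀ j k, Continuous (b j k) := fun j k =>
    continuous_iff_continuousAt.2 fun x => (hb j k x).continuousAt
  let u : ℕ → ℕ → ℕ → ℝ := fun k R j =>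
    (‖b j k 0‖ₑ + ∫⁻ u in Set.Icc (-R : ℝ) R, ‖b j (k + 1) u‖ₑ).toReal
  have hu : ∀ k R, Summable (u k R) := fun k R => ENNReal.summable_toReal (hsum k R)
  have hbound : ∀ k (R : ℕ) j (x : ℝ), |x| ≤ R → ‖b j k x‖ ≤ u k R j := by
    intro k R j x hx
    have h1 := enorm_le_enorm_zero_add_lintegral (hb j k) (hcont j (k + 1)) hx
    have h2 := ENNReal.toReal_mono (ENNReal.ne_top_of_tsum_ne_top (hsum k R) j) h1
    rwa [toReal_enorm] at h2
  have hs : ∀ k x, Summable fun j => b j k x := by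
    intro k x
    obtain ⟨R, hR⟩ := exists_nat_ge |x|
    exact Summable.of_norm_bounded (hu k R) fun j => hbound k R j x hR
  refine ⟨hs, fun k x => ?_⟩
  obtain ⟨R, hR⟩ := exists_nat_gt |x|
  have hxR : x ∈ Metric.ball (0 : ℝ) R := by simpa using hR
  refine hasDerivAt_tsum_of_isPreconnected (hu (k + 1) R) Metric.isOpen_ball
    (convex_ball (0 : ℝ) (R : ℝ)).isPreconnected (fun j y _ => hb j k y) (fun j y hy => ?_) hxR
    (hs k x) hxR
  refine hbound (k + 1) R j y ?_
  have : |y| < R := by simpa using hy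
  exact this.le

theorem lintegral_enorm_le_of_ae_eq_Lp {Ω : Type*} [MeasurableSpace Ω] {P : Measure Ω}
    [IsProbabilityMeasure P] {f : Ω → ℝ} {D : Lp ℝ 2 P} (h : f =ᵐ[P] D) :
    ∫⁻ ω, ‖f ω‖ₑ ∂P ≤ ‖D‖ₑ := by
  rw [lintegral_congr_ae (h.mono fun ω hω => by rw [hω]), ← eLpNorm_one_eq_lintegral_enorm,
    Lp.enorm_def]
  exact eLpNorm_le_eLpNorm_of_exponent_le one_le_two (Lp.aestronglyMeasurable D)

/-- The expected `W^{1,1}` norm on an interval of a process is at most that of the curve it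
represents in `L²`. -/
theorem lintegral_enorm_zero_add_lintegral_le {Ω : Type*} [MeasurableSpace Ω] {P : Measure Ω}
    [IsProbabilityMeasure P] {f f' : ℝ → Ω → ℝ} {D D' : ℝ → Lp ℝ 2 P}
    (hm : Measurable (f 0)) (hm' : Measurable (Function.uncurry f'))
    (h : f 0 =ᵐ[P] D 0) (h' : ∀ x, f' x =ᵐ[P] D' x) (s : Set ℝ) :
    ∫⁻ ω, (‖f 0 ω‖ₑ + ∫⁻ u in s, ‖f' u ω‖ₑ) ∂P ≤ ‖D 0‖ₑ + ∫⁻ u in s, ‖D' u‖ₑ := by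
  rw [lintegral_add_left hm.enorm]
  refine add_le_add (lintegral_enorm_le_of_ae_eq_Lp h) ?_
  rw [lintegral_lintegral_swap]
  · exact lintegral_mono fun u => lintegral_enorm_le_of_ae_eq_Lp (h' u)
  · exact (hm'.comp measurable_swap).enorm.aemeasurable

/-- Dominated convergence: projections are contractions, so the error is at most $2\|D(u)\|$. -/
theorem tendsto_lintegral_enorm_starProjection_sub {H : Type*} [NormedAddCommGroup H]
    [InnerProductSpace ℝ H] {V : ℕ → Submodule ℝ H} [∀ n, (V n).HasOrthogonalProjection]
    {D : ℝ → H} (hD : Continuous D)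
    (hV : ∀ x, Tendsto (fun n => (V n).starProjection (D x)) atTop (𝓝 (D x))) (R : ℝ) :
    Tendsto (fun n => ∫⁻ u in Set.Icc (-R) R, ‖(V n).starProjection (D u) - D u‖ₑ) atTop (𝓝 0) := by
  have h0 : (0 : ℝ≥0∞) = ∫⁻ _ in Set.Icc (-R) R, (0 : ℝ≥0∞) := by simp
  rw [h0]
  refine tendsto_lintegral_of_dominated_convergence (fun u => ‖D u‖ₑ + ‖D u‖ₑ) (fun n => ?_)
    (fun n => ?_) ?_ ?_
  · exact (((V n).starProjection.continuous.comp hD).sub hD).enorm.measurable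
  · refine Eventually.of_forall fun u => enorm_sub_le.trans (add_le_add ?_ le_rfl)
    rw [← ofReal_norm, ← ofReal_norm]
    exact ENNReal.ofReal_le_ofReal ((V n).norm_starProjection_apply_le _)
  · have h1 : IntegrableOn D (Set.Icc (-R) R) := hD.integrableOn_Icc
    rw [lintegral_add_left hD.enorm.measurable]
    exact ENNReal.add_ne_top.2 ⟨h1.2.ne, h1.2.ne⟩
  · refine Eventually.of_forall fun u => ?_
    have := ((hV u).sub_const (D u)).enorm
    simpa using this

/-- A smooth curve in `L²` of a probability space has a version all of whose paths are smooth. -/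
theorem exists_smooth_version {Ω : Type*} [MeasurableSpace Ω] {P : Measure Ω}
    [IsProbabilityMeasure P] (G : ℕ → ℝ → Lp ℝ 2 P)
    (hG : ∀ k x, HasDerivAt (G k) (G (k + 1) x) x) :
    ∃ S : ℝ → Ω → ℝ, (∀ x, Measurable (S x)) ∧ (∀ x, S x =ᵐ[P] G 0 x) ∧
      ∀ ω, ContDiff ℝ (⊤ : ℕ∞) fun x => S x ω := by
  obtain ⟨V, hfin, hV⟩ := exists_finiteDimensional_approx G hG
  choose g hgm hgd hgae using fun n => exists_finiteRank_version (V n) G hG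
  have hGc : ∀ k, Continuous (G k) := fun k =>
    continuous_iff_continuousAt.2 fun x => (hG k x).continuousAt
  have hgmx : ∀ n k x, Measurable (g n k x) := fun n k x =>
    (hgm n k).comp measurable_prodMk_left
  let err : ℕ → ℕ → ℕ → ℝ≥0∞ := fun k R n => ‖(V n).starProjection (G k 0) - G k 0‖ₑ
    + ∫⁻ u in Set.Icc (-R : ℝ) R, ‖(V n).starProjection (G (k + 1) u) - G (k + 1) u‖ₑ
  have herr : ∀ k R, Tendsto (err k R) atTop (𝓝 0) := by
    intro k R
    have h1 := ((hV k 0).sub_const (G k 0)).enorm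
    have h2 := tendsto_lintegral_enorm_starProjection_sub (hGc (k + 1)) (hV (k + 1)) R
    simpa using h1.add h2
  have herr_top : ∀ k R n, err k R n ≠ ∞ := by
    intro k R n
    refine ENNReal.add_ne_top.2 ⟨enorm_ne_top, ?_⟩
    have hc : Continuous fun u => (V n).starProjection (G (k + 1) u) - G (k + 1) u :=
      ((V n).starProjection.continuous.comp (hGc _)).sub (hGc _)
    have h1 : IntegrableOn _ (Set.Icc (-R : ℝ) R) := hc.integrableOn_Icc
    exact h1.2.ne
  -- Diagonal choice: a fixed pair `(k, R)` is controlled by $2^{-j}$ as soon as `j ≥ max k R`, so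
  -- one subsequence serves all derivatives and intervals.
  have hchoose : ∀ j : ℕ, ∃ n, j ≤ n ∧ ∀ k ≤ j, ∀ R ≤ j, err k R n ≤ 2⁻¹ ^ j := by
    intro j
    have hpos : (0 : ℝ≥0∞) < 2⁻¹ ^ j := ENNReal.pow_pos (by simp) _
    have h1 : ∀ᶠ n in atTop, ∀ k ∈ Set.Iic j, ∀ R ∈ Set.Iic j, err k R n ≤ 2⁻¹ ^ j := by
      rw [eventually_all_finite (Set.finite_Iic j)]
      intro k _
      rw [eventually_all_finite (Set.finite_Iic j)]
      intro R _
      exact (herr k R).eventually_le_const hpos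
    obtain ⟨n, h2, h3⟩ := ((eventually_ge_atTop j).and h1).exists
    exact ⟨n, h2, h3⟩
  choose N hNj hN using hchoose
  have hNtop : Tendsto N atTop atTop := tendsto_atTop_mono hNj tendsto_id
  let b : ℕ → ℕ → ℝ → Ω → ℝ := fun j k x ω => g (N (j + 1)) k x ω - g (N j) k x ω
  let M : ℕ → ℕ → ℕ → Ω → ℝ≥0∞ := fun k R j ω =>
    ‖b j k 0 ω‖ₑ + ∫⁻ u in Set.Icc (-R : ℝ) R, ‖b j (k + 1) u ω‖ₑ
  have hbm : ∀ j k, Measurable (Function.uncurry (b j k)) := fun j k =>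
    (hgm (N (j + 1)) k).sub (hgm (N j) k)
  have hbmx : ∀ j k x, Measurable (b j k x) := fun j k x =>
    (hbm j k).comp measurable_prodMk_left
  have hMm : ∀ k R j, Measurable (M k R j) := fun k R j =>
    (hbmx j k 0).enorm.add (Measurable.lintegral_prod_left' (hbm j (k + 1)).enorm)
  have hbae : ∀ j k x, b j k x =ᵐ[P]
      ((V (N (j + 1))).starProjection (G k x) - (V (N j)).starProjection (G k x) : Lp ℝ 2 P) := by
    intro j k x
    filter_upwards [hgae (N (j + 1)) k x, hgae (N j) k x,
      Lp.coeFn_sub ((V (N (j + 1))).starProjection (G k x)) ((V (N j)).starProjection (G k x))]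
      with ω h1 h2 h3
    rw [h3, Pi.sub_apply, ← h1, ← h2]
  have htri : ∀ j k x, ‖(V (N (j + 1))).starProjection (G k x) -
      (V (N j)).starProjection (G k x)‖ₑ ≤ ‖(V (N (j + 1))).starProjection (G k x) - G k x‖ₑ
        + ‖(V (N j)).starProjection (G k x) - G k x‖ₑ := by
    intro j k x
    rw [← sub_sub_sub_cancel_right _ _ (G k x)]
    exact enorm_sub_le
  have hMint : ∀ k R j, ∫⁻ ω, M k R j ω ∂P ≤ err k R (N (j + 1)) + err k R (N j) := by
    intro k R j
    refine (lintegral_enorm_zero_add_lintegral_le (f := b j k)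
      (D := fun x => (V (N (j + 1))).starProjection (G k x) - (V (N j)).starProjection (G k x))
      (D' := fun x => (V (N (j + 1))).starProjection (G (k + 1) x) -
        (V (N j)).starProjection (G (k + 1) x)) (hbmx j k 0) (hbm j (k + 1))
      (hbae j k 0) (hbae j (k + 1)) _).trans ?_
    refine (add_le_add (htri j k 0) (lintegral_mono fun u => htri j (k + 1) u)).trans_eq ?_
    rw [lintegral_add_left]
    · exact add_add_add_comm _ _ _ _
    · exact (((V _).starProjection.continuous.comp (hGc _)).sub (hGc _)).enorm.measurable
  have hgood : ∀ᵐ ω ∂P, ∀ k R, ∑' j, M k R j ω ≠ ∞ := by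
    rw [ae_all_iff]; intro k
    rw [ae_all_iff]; intro R
    have hint : ∫⁻ ω, ∑' j, M k R j ω ∂P ≠ ∞ := by
      rw [lintegral_tsum fun j => (hMm k R j).aemeasurable]
      let m := max k R
      -- The geometric bound holds only from index `m` on; the earlier terms are merely finite.
      rw [← ENNReal.summable.sum_add_tsum_nat_add' (k := m)]
      refine ENNReal.add_ne_top.2 ⟨?_, ?_⟩
      · refine ENNReal.sum_ne_top.2 fun j _ => ?_
        exact ((hMint k R j).trans_lt (ENNReal.add_lt_top.2
          ⟨(herr_top _ _ _).lt_top, (herr_top _ _ _).lt_top⟩)).ne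
      · have hle : ∀ j, ∫⁻ ω, M k R (j + m) ω ∂P ≤ 2⁻¹ ^ j + 2⁻¹ ^ j := by
          intro j
          have hk : k ≤ m := le_max_left _ _
          have hR : R ≤ m := le_max_right _ _
          have h2 : (2⁻¹ : ℝ≥0∞) ≤ 1 := by simp
          refine (hMint k R (j + m)).trans (add_le_add ?_ ?_)
          · exact (hN (j + m + 1) k (by omega) R (by omega)).trans
              (pow_le_pow_right_of_le_one' h2 (by omega))
          · exact (hN (j + m) k (by omega) R (by omega)).trans
              (pow_le_pow_right_of_le_one' h2 (by omega))
        refine ((ENNReal.tsum_le_tsum hle).trans_lt ?_).ne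
        rw [ENNReal.tsum_add, ENNReal.tsum_geometric]
        simp
    exact (ae_lt_top' (AEMeasurable.tsum fun j => (hMm k R j).aemeasurable) hint).mono
      fun ω hω => hω.ne
  let A : Set Ω := {ω | ∀ k R, ∑' j, M k R j ω ≠ ∞}
  have hA : MeasurableSet A := by
    have : A = ⋂ k, ⋂ R, {ω | ∑' j, M k R j ω ≠ ∞} := by ext; simp [A]
    rw [this]
    refine MeasurableSet.iInter fun k => MeasurableSet.iInter fun R => ?_
    exact (Measurable.tsum fun j => hMm k R j) (measurableSet_singleton ∞).compl
  have hpath : ∀ ω ∈ A, (∀ k x, Summable fun j => b j k x ω) ∧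
      ∀ k x, HasDerivAt (fun y => ∑' j, b j k y ω) (∑' j, b j (k + 1) x ω) x := by
    intro ω hω
    exact hasDerivAt_tsum_of_tsum_lintegral_ne_top (b := fun j k x => b j k x ω)
      (fun j k x => (hgd (N (j + 1)) k x ω).sub (hgd (N j) k x ω)) hω
  have htend : ∀ ω ∈ A, ∀ x, Tendsto (fun n => g (N n) 0 x ω) atTop
      (𝓝 (g (N 0) 0 x ω + ∑' j, b j 0 x ω)) := by
    intro ω hω x
    have h1 := (((hpath ω hω).1 0 x).hasSum.tendsto_sum_nat).const_add (g (N 0) 0 x ω)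
    refine h1.congr fun n => ?_
    rw [Finset.sum_range_sub (fun j => g (N j) 0 x ω)]
    ring
  -- The version is the limit of the telescoping sums on the full-measure set `A` and zero
  -- elsewhere, so no path is exceptional.
  refine ⟨fun x => A.indicator fun ω => g (N 0) 0 x ω + ∑' j, b j 0 x ω, fun x => ?_,
    fun x => ?_, fun ω => ?_⟩
  · refine measurable_of_tendsto_metrizable (f := fun n => A.indicator (g (N n) 0 x))
      (fun n => (hgmx _ _ _).indicator hA) ?_
    rw [tendsto_pi_nhds]
    intro ω
    by_cases hω : ω ∈ A
    · simpa [hω] using htend ω hω x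
    · simp [hω]
  -- The pointwise limit is identified with `G 0 x` through an almost surely convergent subsequence
  -- of the projections.
  · have h1 : TendstoInMeasure P (fun n => ((V (N n)).starProjection (G 0 x) : Ω → ℝ)) atTop
        (G 0 x) := tendstoInMeasure_of_tendsto_Lp ((hV 0 x).comp hNtop)
    obtain ⟨ns, hns, hae⟩ := h1.exists_seq_tendsto_ae
    have h2 : ∀ᵐ ω ∂P, ∀ n, g (N n) 0 x ω = (V (N n)).starProjection (G 0 x) ω :=
      ae_all_iff.2 fun n => hgae (N n) 0 x
    filter_upwards [hgood, hae, h2] with ω hω h3 h4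
    rw [Set.indicator_of_mem (show ω ∈ A from hω)]
    refine tendsto_nhds_unique ((htend ω hω x).comp hns.tendsto_atTop) (h3.congr fun n => ?_)
    exact (h4 _).symm
  · by_cases hω : ω ∈ A
    · simp only [Set.indicator_of_mem hω]
      exact contDiff_of_hasDerivAt_succ
        (F := fun k x => g (N 0) k x ω + ∑' j, b j k x ω)
        fun k x => (hgd (N 0) k x ω).add ((hpath ω hω).2 k x)
    · simp only [Set.indicator_of_notMem hω]
      exact contDiff_const

/-! ### The spectral curve -/

/-- Taylor's bound for $|r|\le1$; otherwise the left side is at most $2+|r|\le3r^2$. -/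
theorem norm_cexp_I_mul_sub_one_sub_le (r : ℝ) :
    ‖Complex.exp (Complex.I * r) - 1 - Complex.I * r‖ ≤ 3 * r ^ 2 := by
  have hn : ‖Complex.I * (r : ℂ)‖ = |r| := by simp
  rcases le_total |r| 1 with h | h
  · have := Complex.norm_exp_sub_one_sub_id_le (x := Complex.I * r) (by rwa [hn])
    rw [hn, sq_abs] at this
    nlinarith [sq_nonneg r]
  · have h1 : ‖Complex.exp (Complex.I * r)‖ = 1 := by
      rw [mul_comm]; exact Complex.norm_exp_ofReal_mul_I r
    have h2 : ‖Complex.exp (Complex.I * r) - 1 - Complex.I * r‖ ≤ 1 + 1 + |r| := by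
      refine (norm_sub_le _ _).trans (add_le_add ((norm_sub_le _ _).trans ?_) hn.le)
      rw [h1]; simp
    have h3 : |r| ≤ r ^ 2 := by rw [← sq_abs]; nlinarith
    linarith

/-- If all moments of the spectral density `w²` are finite, then `x ↦ w exp(i x ξ)` is a smooth
curve in `L²`. -/
theorem exists_smooth_spectral_curve {Z : Type*} [MeasurableSpace Z] {m : Measure Z}
    {w ξ : Z → ℝ} (hξ : Measurable ξ) (hw : ∀ k : ℕ, MemLp (fun z => ξ z ^ k * w z) 2 m) :
    ∃ e : ℕ → ℝ → Lp ℂ 2 m, (∀ k x, HasDerivAt (e k) (e (k + 1) x) x) ∧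
      ∀ x y, inner ℝ (e 0 x) (e 0 y) = ∫ z, w z ^ 2 * Real.cos ((x - y) * ξ z) ∂m := by
  let f : ℕ → ℝ → Z → ℂ := fun k x z =>
    (Complex.I * ξ z) ^ k * w z * Complex.exp (Complex.I * (x * ξ z : ℝ))
  have hexp : ∀ r : ℝ, ‖Complex.exp (Complex.I * r)‖ = 1 := fun r => by
    rw [mul_comm]; exact Complex.norm_exp_ofReal_mul_I r
  have hnorm : ∀ k x z, ‖f k x z‖ = ‖ξ z ^ k * w z‖ := by
    intro k x z
    simp only [f, norm_mul, hexp, norm_pow, Complex.norm_I, Complex.norm_real, one_mul, mul_one]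
  have hwm : AEStronglyMeasurable w m := by
    have := (hw 0).aestronglyMeasurable
    simpa using this
  have hfm : ∀ k x, AEStronglyMeasurable (f k x) m := by
    intro k x
    have h1 : Measurable fun z => (Complex.I * ξ z) ^ k := by fun_prop
    have h2 : Measurable fun z => Complex.exp (Complex.I * (x * ξ z : ℝ)) := by fun_prop
    have h3 : AEStronglyMeasurable (fun z => (w z : ℂ)) m :=
      Complex.continuous_ofReal.comp_aestronglyMeasurable hwm
    exact (h1.aestronglyMeasurable.mul h3).mul h2.aestronglyMeasurable
  have hf : ∀ k x, MemLp (f k x) 2 m := fun k x =>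
    (hw k).of_le (hfm k x) (Eventually.of_forall fun z => (hnorm k x z).le)
  refine ⟨fun k x => (hf k x).toLp, fun k x => ?_, fun x y => ?_⟩
  · rw [hasDerivAt_iff_isLittleO_nhds_zero]
    refine Asymptotics.IsBigO.trans_isLittleO (g := fun h : ℝ => h ^ 2) ?_ ?_
    · refine Asymptotics.IsBigO.of_bound (3 * ‖(hf (k + 2) 0).toLp‖) (Eventually.of_forall ?_)
      intro h
      -- The remainder costs two further powers of $\xi$; its $L^2$ norm is $O(h^2)$ by finiteness
      -- of moment `k + 2`.
      have key : ‖(hf k (x + h)).toLp - (hf k x).toLp - h • (hf (k + 1) x).toLp‖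
          ≤ (3 * h ^ 2) * ‖(hf (k + 2) 0).toLp‖ := by
        refine Lp.norm_le_mul_norm_of_ae_le_mul ?_
        filter_upwards [Lp.coeFn_sub ((hf k (x + h)).toLp - (hf k x).toLp)
            (h • (hf (k + 1) x).toLp), Lp.coeFn_sub (hf k (x + h)).toLp (hf k x).toLp,
            Lp.coeFn_smul h (hf (k + 1) x).toLp, (hf k (x + h)).coeFn_toLp,
            (hf k x).coeFn_toLp, (hf (k + 1) x).coeFn_toLp, (hf (k + 2) 0).coeFn_toLp]
          with z h1 h2 h3 h4 h5 h6 h7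
        rw [h1, Pi.sub_apply, h2, Pi.sub_apply, h3, Pi.smul_apply, h4, h5, h6, h7]
        have hid : f k (x + h) z - f k x z - h • f (k + 1) x z = f k x z *
            (Complex.exp (Complex.I * (h * ξ z : ℝ)) - 1 - Complex.I * (h * ξ z : ℝ)) := by
          simp only [f, Complex.real_smul]
          have : Complex.exp (Complex.I * ((x + h) * ξ z : ℝ)) =
              Complex.exp (Complex.I * (x * ξ z : ℝ)) *
                Complex.exp (Complex.I * (h * ξ z : ℝ)) := by
            rw [← Complex.exp_add]; congr 1; push_cast; ring
          rw [this]; push_cast; ring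
        rw [hid, norm_mul, hnorm, hnorm]
        calc _ ≤ ‖ξ z ^ k * w z‖ * (3 * (h * ξ z) ^ 2) :=
              mul_le_mul_of_nonneg_left (norm_cexp_I_mul_sub_one_sub_le _) (norm_nonneg _)
          _ = _ := by
              rw [pow_add, mul_right_comm (ξ z ^ k), norm_mul (_ * w z),
                Real.norm_of_nonneg (sq_nonneg (ξ z))]
              ring
      refine key.trans_eq ?_
      rw [Real.norm_of_nonneg (sq_nonneg h)]
      ring
    · simpa using Asymptotics.isLittleO_pow_id (𝕜 := ℝ) one_lt_two
  · rw [L2.inner_def]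
    refine integral_congr_ae ?_
    filter_upwards [(hf 0 x).coeFn_toLp, (hf 0 y).coeFn_toLp] with z h1 h2
    rw [h1, h2]
    simp only [f, pow_zero, one_mul, Complex.inner, map_mul, Complex.conj_ofReal]
    have h3 : (starRingEnd ℂ) (Complex.exp (Complex.I * (x * ξ z : ℝ))) =
        Complex.exp (Complex.I * (-(x * ξ z) : ℝ)) := by
      rw [← Complex.exp_conj]; simp
    have h4 : (w z : ℂ) * Complex.exp (Complex.I * (y * ξ z : ℝ)) *
        ((w z : ℂ) * Complex.exp (Complex.I * (-(x * ξ z) : ℝ))) =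
        ((w z ^ 2 : ℝ) : ℂ) * Complex.exp ((-((x - y) * ξ z) : ℝ) * Complex.I) := by
      have : Complex.exp ((-((x - y) * ξ z) : ℝ) * Complex.I) =
          Complex.exp (Complex.I * (y * ξ z : ℝ)) *
            Complex.exp (Complex.I * (-(x * ξ z) : ℝ)) := by
        rw [← Complex.exp_add]; congr 1; push_cast; ring
      rw [this]; push_cast; ring
    rw [h3, h4, Complex.re_ofReal_mul, Complex.exp_ofReal_mul_I_re, Real.cos_neg]

/-! ### Wiener integrals and the Itô isometry -/

theorem IsWhiteNoise.memLp {E : Type*} [MeasurableSpace E] {m : Measure E} {Ω : Type*}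
    [MeasurableSpace Ω] {W : Set E → Ω → ℝ} {P : Measure Ω} (hW : IsWhiteNoise m W P)
    {A : Set E} (hA : MeasurableSet A) (hmA : m A < ∞) : MemLp (W A) 2 P :=
  (hW.gaussian.hasGaussianLaw_eval ⟨A, hA, hmA⟩).memLp_two

/-- The level set of `c = 0` may have infinite measure, where `W` is uncontrolled; the factor `c`
removes it. -/
theorem memLp_const_mul_preimage {E : Type*} [MeasurableSpace E] {m : Measure E} {Ω : Type*}
    [MeasurableSpace Ω] {W : Set E → Ω → ℝ} {P : Measure Ω}
    (hW : ∀ A, MeasurableSet A → m A < ∞ → MemLp (W A) 2 P) {g : SimpleFunc E ℝ}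
    (hg : MemLp g 2 m) (c : ℝ) : MemLp (fun ω => c * W (g ⁻¹' {c}) ω) 2 P := by
  rcases eq_or_ne c 0 with rfl | hc
  · simp
  · exact (hW _ (g.measurableSet_preimage _) (SimpleFunc.measure_preimage_lt_top_of_memLp
      two_ne_zero ENNReal.ofNat_ne_top g hg c hc)).const_mul c

theorem memLp_simpleWienerIntegral {E : Type*} [MeasurableSpace E] {m : Measure E} {Ω : Type*}
    [MeasurableSpace Ω] {W : Set E → Ω → ℝ} {P : Measure Ω}
    (hW : ∀ A, MeasurableSet A → m A < ∞ → MemLp (W A) 2 P) {g : SimpleFunc E ℝ}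
    (hg : MemLp g 2 m) : MemLp (simpleWienerIntegral W g) 2 P :=
  memLp_finsetSum g.range fun c _ => memLp_const_mul_preimage hW hg c

/-- Assuming only the covariances lets this apply both to white noise and to the deterministic
"noise" $A\mapsto 1_A$ on $(E,m)$. The integral against the latter is `g` itself, so comparing the
two yields the isometry without refining partitions. -/
theorem integral_simpleWienerIntegral_mul {E : Type*} [MeasurableSpace E] {m : Measure E}
    {Ω : Type*} [MeasurableSpace Ω] {W : Set E → Ω → ℝ} {P : Measure Ω}
    (hW : ∀ A, MeasurableSet A → m A < ∞ → MemLp (W A) 2 P)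
    (hcov : ∀ A B, MeasurableSet A → m A < ∞ → MeasurableSet B → m B < ∞ →
      ∫ ω, W A ω * W B ω ∂P = (m (A ∩ B)).toReal)
    {g g' : SimpleFunc E ℝ} (hg : MemLp g 2 m) (hg' : MemLp g' 2 m) :
    ∫ ω, simpleWienerIntegral W g ω * simpleWienerIntegral W g' ω ∂P =
      ∑ c ∈ g.range, ∑ c' ∈ g'.range, c * c' * (m (g ⁻¹' {c} ∩ g' ⁻¹' {c'})).toReal := by
  have hint : ∀ c c', Integrable (fun ω => c * W (g ⁻¹' {c}) ω * (c' * W (g' ⁻¹' {c'}) ω)) P :=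
    fun c c' => MemLp.integrable_mul (memLp_const_mul_preimage hW hg c)
      (memLp_const_mul_preimage hW hg' c')
  simp only [simpleWienerIntegral, Finset.sum_mul_sum]
  rw [integral_finsetSum _ fun c _ => integrable_finsetSum _ fun c' _ => hint c c']
  refine Finset.sum_congr rfl fun c _ => ?_
  rw [integral_finsetSum _ fun c' _ => hint c c']
  refine Finset.sum_congr rfl fun c' _ => ?_
  rcases eq_or_ne c 0 with rfl | hc
  · simp
  rcases eq_or_ne c' 0 with rfl | hc'
  · simp
  rw [← hcov _ _ (g.measurableSet_preimage _) (SimpleFunc.measure_preimage_lt_top_of_memLp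
      two_ne_zero ENNReal.ofNat_ne_top g hg c hc) (g'.measurableSet_preimage _)
      (SimpleFunc.measure_preimage_lt_top_of_memLp two_ne_zero ENNReal.ofNat_ne_top g' hg' c' hc'),
    ← integral_const_mul]
  exact integral_congr_ae (Eventually.of_forall fun ω => by ring)

theorem simpleWienerIntegral_indicator {E : Type*} [MeasurableSpace E] (g : SimpleFunc E ℝ) :
    simpleWienerIntegral (fun A : Set E => A.indicator fun _ => (1 : ℝ)) g = g := by
  ext q
  rw [simpleWienerIntegral, Finset.sum_eq_single (g q)]
  · simp
  · intro c _ hc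
    simp [hc.symm]
  · intro h
    exact absurd (g.mem_range_self q) h

/-- The Itô isometry for simple functions. -/
theorem IsWhiteNoise.integral_simple_mul {E : Type*} [MeasurableSpace E] {m : Measure E}
    {Ω : Type*} [MeasurableSpace Ω] {W : Set E → Ω → ℝ} {P : Measure Ω} (hW : IsWhiteNoise m W P)
    {g g' : SimpleFunc E ℝ} (hg : MemLp g 2 m) (hg' : MemLp g' 2 m) :
    ∫ ω, simpleWienerIntegral W g ω * simpleWienerIntegral W g' ω ∂P = ∫ q, g q * g' q ∂m := by
  rw [integral_simpleWienerIntegral_mul (fun A => hW.memLp) hW.cov hg hg',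
    ← integral_simpleWienerIntegral_mul (W := fun A : Set E => A.indicator fun _ => (1 : ℝ))
      (P := m) (m := m) ?_ ?_ hg hg']
  · simp only [simpleWienerIntegral_indicator]
  · intro A hA hmA
    exact memLp_indicator_const 2 hA 1 (Or.inr hmA.ne)
  · intro A B hA _ hB _
    have : ∀ q, A.indicator (fun _ => (1 : ℝ)) q * B.indicator (fun _ => (1 : ℝ)) q =
        (A ∩ B).indicator (fun _ => (1 : ℝ)) q := by
      intro q
      by_cases h1 : q ∈ A <;> by_cases h2 : q ∈ B <;> simp [h1, h2]
    simp only [this]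
    rw [integral_indicator (hA.inter hB)]
    simp [Measure.real]

theorem inner_toLp_eq_integral_mul {E : Type*} [MeasurableSpace E] {m : Measure E} {f g : E → ℝ}
    (hf : MemLp f 2 m) (hg : MemLp g 2 m) :
    inner ℝ hf.toLp hg.toLp = ∫ q, f q * g q ∂m := by
  rw [L2.inner_def]
  refine integral_congr_ae ?_
  filter_upwards [hf.coeFn_toLp, hg.coeFn_toLp] with q h1 h2
  rw [h1, h2]
  simp [mul_comm]

theorem IsWhiteNoise.inner_toLp_simple {E : Type*} [MeasurableSpace E] {m : Measure E}
    {Ω : Type*} [MeasurableSpace Ω] {W : Set E → Ω → ℝ} {P : Measure Ω} (hW : IsWhiteNoise m W P)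
    {g g' : SimpleFunc E ℝ} (hg : MemLp g 2 m) (hg' : MemLp g' 2 m) :
    inner ℝ (memLp_simpleWienerIntegral (fun _ => hW.memLp) hg).toLp
      (memLp_simpleWienerIntegral (fun _ => hW.memLp) hg').toLp = inner ℝ hg.toLp hg'.toLp := by
  rw [inner_toLp_eq_integral_mul, inner_toLp_eq_integral_mul, hW.integral_simple_mul hg hg']

/-- The Itô isometry. -/
theorem IsWienerIntegral.inner_toLp {E : Type*} [MeasurableSpace E] {m : Measure E} {Ω : Type*}
    [MeasurableSpace Ω] {W : Set E → Ω → ℝ} {P : Measure Ω} (hW : IsWhiteNoise m W P)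
    {f f' : E → ℝ} {Y Y' : Ω → ℝ} (h : IsWienerIntegral m W P f Y)
    (h' : IsWienerIntegral m W P f' Y') :
    inner ℝ h.memLp.toLp h'.memLp.toLp = ∫ q, f q * f' q ∂m := by
  rw [← inner_toLp_eq_integral_mul h.memLp_integrand h'.memLp_integrand]
  obtain ⟨g, hg, hgf, hgY⟩ := h.approx
  obtain ⟨g', hg', hgf', hgY'⟩ := h'.approx
  have h1 := (Lp.tendsto_Lp_iff_tendsto_eLpNorm'' _ hg _ h.memLp_integrand).2 hgf
  have h2 := (Lp.tendsto_Lp_iff_tendsto_eLpNorm'' _ hg' _ h'.memLp_integrand).2 hgf'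
  have h3 := (Lp.tendsto_Lp_iff_tendsto_eLpNorm'' _
    (fun n => memLp_simpleWienerIntegral (fun _ => hW.memLp) (hg n)) _ h.memLp).2 hgY
  have h4 := (Lp.tendsto_Lp_iff_tendsto_eLpNorm'' _
    (fun n => memLp_simpleWienerIntegral (fun _ => hW.memLp) (hg' n)) _ h'.memLp).2 hgY'
  exact tendsto_nhds_unique (h3.inner h4)
    ((h1.inner h2).congr fun n => (hW.inner_toLp_simple (hg n) (hg' n)).symm)

/-- The isometry carries a Cauchy sequence of simple integrands to a Cauchy sequence in the complete
space $L^2(P)$. -/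
theorem IsWhiteNoise.exists_isWienerIntegral {E : Type*} [MeasurableSpace E] {m : Measure E}
    {Ω : Type*} [MeasurableSpace Ω] {W : Set E → Ω → ℝ} {P : Measure Ω} (hW : IsWhiteNoise m W P)
    {f : E → ℝ} (hf : MemLp f 2 m) : ∃ Y, IsWienerIntegral m W P f Y := by
  have hex : ∀ n : ℕ, ∃ g : SimpleFunc E ℝ,
      eLpNorm (f - ⇑g) 2 m < ((n : ℝ≥0∞) + 1)⁻¹ ∧ MemLp g 2 m := fun n =>
    hf.exists_simpleFunc_eLpNorm_sub_lt ENNReal.ofNat_ne_top (by simp)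
  choose g hgf hg using hex
  have hlim : Tendsto (fun n => eLpNorm (fun q => g n q - f q) 2 m) atTop (𝓝 0) := by
    have h0 : Tendsto (fun n : ℕ => ((n : ℝ≥0∞) + 1)⁻¹) atTop (𝓝 0) := by
      have := (tendsto_add_atTop_iff_nat 1).2 ENNReal.tendsto_inv_nat_nhds_zero
      simpa using this
    refine tendsto_of_tendsto_of_tendsto_of_le_of_le tendsto_const_nhds h0 (fun _ => zero_le) ?_
    intro n
    have := eLpNorm_sub_comm f (g n) 2 m
    exact (this.symm.trans_le (hgf n).le)
  have hJ := fun n => memLp_simpleWienerIntegral (fun _ => hW.memLp) (hg n)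
  have h1 := (Lp.tendsto_Lp_iff_tendsto_eLpNorm'' _ hg _ hf).2 hlim
  have hdist : ∀ i j, dist (hJ i).toLp (hJ j).toLp = dist (hg i).toLp (hg j).toLp := by
    intro i j
    have hsq : ‖(hJ i).toLp - (hJ j).toLp‖ ^ 2 = ‖(hg i).toLp - (hg j).toLp‖ ^ 2 := by
      rw [← real_inner_self_eq_norm_sq, ← real_inner_self_eq_norm_sq, real_inner_sub_sub_self,
        real_inner_sub_sub_self]
      rw [hW.inner_toLp_simple, hW.inner_toLp_simple, hW.inner_toLp_simple]
    rw [dist_eq_norm, dist_eq_norm]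
    exact (pow_left_inj₀ (norm_nonneg _) (norm_nonneg _) two_ne_zero).1 hsq
  have hC : CauchySeq fun n => (hJ n).toLp := by
    have := h1.cauchySeq
    rw [Metric.cauchySeq_iff] at this ⊢
    simpa only [hdist] using this
  obtain ⟨y, hy⟩ := cauchySeq_tendsto_of_complete hC
  refine ⟨y, hf, Lp.memLp y, g, hg, hlim, ?_⟩
  refine (Lp.tendsto_Lp_iff_tendsto_eLpNorm'' _ hJ _ (Lp.memLp y)).1 ?_
  rwa [Lp.toLp_coeFn]

/-! ### Fourier inversion and Plancherel for probability measures -/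

section FourierInversion

open scoped FourierTransform

/-- The density of `μ` given by Fourier inversion, if the characteristic function is integrable. -/
noncomputable def inverseCharFun (μ : Measure ℝ) (z : ℝ) : ℂ :=
  (2 * Real.pi : ℂ)⁻¹ * ∫ ξ : ℝ, Complex.exp (-(Complex.I * ξ * z)) * charFun μ ξ

theorem fourier_charFun_eq_inverseCharFun (μ : Measure ℝ) :
    𝓕 (fun v : ℝ => charFun μ (2 * Real.pi * v)) = inverseCharFun μ := by
  ext z
  rw [Real.fourier_real_eq_integral_exp_smul, inverseCharFun]
  have h := Measure.integral_comp_mul_left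
    (fun ξ : ℝ => Complex.exp (-(Complex.I * ξ * z)) * charFun μ ξ) (2 * Real.pi)
  rw [abs_of_pos (by positivity), Complex.real_smul] at h
  push_cast at h
  rw [← h]
  refine integral_congr_ae (Eventually.of_forall fun v => ?_)
  simp only [smul_eq_mul]
  congr 2
  push_cast
  ring

/-- Fubini and the Gaussian Fourier transform: damping the inversion integral by a Gaussian amounts
to convolving `μ` with a normal density of variance $1/(2\pi^2c)$. -/
theorem integral_cexp_neg_mul_sq_mul_charFun (μ : Measure ℝ) [IsProbabilityMeasure μ] {c : ℝ}
    (hc : 0 < c) (z : ℝ) :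
    ∫ v : ℝ, Complex.exp (-c⁻¹ * ‖v‖ ^ 2) •
        (Complex.exp (-(2 * Real.pi * v * z) * Complex.I) • charFun μ (2 * Real.pi * v)) =
      ((∫ x, √(Real.pi * c) * Real.exp (-(Real.pi ^ 2 * c) * (z - x) ^ 2) ∂μ : ℝ) : ℂ) := by
  have h1 : ∀ v : ℝ, Complex.exp (-c⁻¹ * ‖v‖ ^ 2) •
        (Complex.exp (-(2 * Real.pi * v * z) * Complex.I) • charFun μ (2 * Real.pi * v)) =
      ∫ x, Complex.exp (-c⁻¹ * v ^ 2 + (2 * Real.pi * (x - z) * Complex.I) * v) ∂μ := by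
    intro v
    rw [charFun_apply_real, smul_eq_mul, smul_eq_mul, ← mul_assoc, ← integral_const_mul]
    refine integral_congr_ae (Eventually.of_forall fun x => ?_)
    simp only
    rw [← Complex.exp_add, ← Complex.exp_add, Real.norm_eq_abs, ← Complex.ofReal_pow, sq_abs]
    congr 1
    push_cast
    ring
  simp only [h1]
  rw [integral_integral_swap]
  · rw [← integral_complex_ofReal]
    refine integral_congr_ae (Eventually.of_forall fun x => ?_)
    have h2 := integral_cexp_quadratic (b := -((c⁻¹ : ℝ) : ℂ)) (by
      rw [← Complex.ofReal_neg, Complex.ofReal_re]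
      exact neg_neg_of_pos (inv_pos.2 hc)) (2 * Real.pi * (x - z) * Complex.I) 0
    simp only [add_zero] at h2
    simp only
    rw [h2]
    have h3 : (Real.pi / - -((c⁻¹ : ℝ) : ℂ)) ^ (1 / 2 : ℂ) = (√(Real.pi * c) : ℝ) := by
      rw [neg_neg, Complex.ofReal_inv, div_inv_eq_mul, ← Complex.ofReal_mul, Real.sqrt_eq_rpow,
        Complex.ofReal_cpow (by positivity)]
      norm_num
    rw [h3, Complex.ofReal_mul, Complex.ofReal_exp]
    congr 2
    have hc' : (c : ℂ) ≠ 0 := by exact_mod_cast hc.ne'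
    push_cast
    field_simp
    rw [Complex.I_sq]
    ring
  · have hg : Integrable (fun v : ℝ => Real.exp (-c⁻¹ * v ^ 2)) :=
      integrable_exp_neg_mul_sq (inv_pos.2 hc)
    have hg2 : Integrable (fun p : ℝ × ℝ => Real.exp (-c⁻¹ * p.1 ^ 2)) (volume.prod μ) :=
      hg.comp_fst μ
    refine hg2.mono' (by fun_prop) (Eventually.of_forall fun p => ?_)
    simp only [Function.uncurry]
    rw [Complex.norm_exp]
    refine (Real.exp_le_exp.2 (le_of_eq ?_))
    simp [← Complex.ofReal_pow]

/-- Removing the damping exhibits the inversion integral as a limit of nonnegative mollified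
densities, whence its positivity and, by Fatou, its integrability. -/
theorem tendsto_inverseCharFun {μ : Measure ℝ} [IsProbabilityMeasure μ]
    (hμ : Integrable (charFun μ)) (z : ℝ) :
    Tendsto (fun c : ℝ =>
      ((∫ x, √(Real.pi * c) * Real.exp (-(Real.pi ^ 2 * c) * (z - x) ^ 2) ∂μ : ℝ) : ℂ)) atTop
      (𝓝 (inverseCharFun μ z)) := by
  have hψ : Integrable fun v : ℝ => charFun μ (2 * Real.pi * v) :=
    hμ.comp_mul_left' (by positivity)
  have hint : Integrable fun v : ℝ =>
      Complex.exp (-(2 * Real.pi * v * z) * Complex.I) • charFun μ (2 * Real.pi * v) := by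
    refine hψ.norm.mono' (by fun_prop) (Eventually.of_forall fun v => ?_)
    have : ‖Complex.exp (-(2 * Real.pi * v * z) * Complex.I)‖ = 1 := by
      have := Complex.norm_exp_ofReal_mul_I (-(2 * Real.pi * v * z))
      push_cast at this
      exact this
    rw [norm_smul, this, one_mul]
  have h := Real.tendsto_integral_cexp_sq_smul hint
  rw [← fourier_charFun_eq_inverseCharFun, Real.fourier_real_eq_integral_exp_smul]
  have heq : (∫ v : ℝ, Complex.exp (-(2 * Real.pi * v * z) * Complex.I) •
      charFun μ (2 * Real.pi * v)) = ∫ v : ℝ, Complex.exp (↑(-2 * Real.pi * v * z) * Complex.I) •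
      charFun μ (2 * Real.pi * v) := by
    refine integral_congr_ae (Eventually.of_forall fun v => ?_)
    simp only
    congr 3
    push_cast
    ring
  rw [heq] at h
  refine h.congr' ?_
  filter_upwards [eventually_gt_atTop 0] with c hc
  rw [← integral_cexp_neg_mul_sq_mul_charFun μ hc z]

theorem inverseCharFun_nonneg {μ : Measure ℝ} [IsProbabilityMeasure μ]
    (hμ : Integrable (charFun μ)) (z : ℝ) :
    0 ≤ (inverseCharFun μ z).re ∧ ((inverseCharFun μ z).re : ℂ) = inverseCharFun μ z := by
  have h := tendsto_inverseCharFun hμ z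
  constructor
  · have h1 := (Complex.continuous_re.tendsto _).comp h
    refine ge_of_tendsto' h1 fun c => ?_
    simp only [Function.comp_apply, Complex.ofReal_re]
    exact integral_nonneg fun x => by positivity
  · have h1 := (Complex.continuous_im.tendsto _).comp h
    have h2 : (inverseCharFun μ z).im = 0 := by
      refine tendsto_nhds_unique h1 ?_
      simp [Function.comp_def]
    exact Complex.ext (by simp) (by simp [h2])

theorem lintegral_gaussian_kernel_eq_one {c : ℝ} (hc : 0 < c) (x : ℝ) :
    ∫⁻ z, ENNReal.ofReal (√(Real.pi * c) * Real.exp (-(Real.pi ^ 2 * c) * (z - x) ^ 2)) = 1 := by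
  have hb : 0 < Real.pi ^ 2 * c := by positivity
  have hint : Integrable fun z : ℝ => √(Real.pi * c) * Real.exp (-(Real.pi ^ 2 * c) * z ^ 2) :=
    (integrable_exp_neg_mul_sq hb).const_mul _
  rw [lintegral_sub_right_eq_self (μ := volume) (fun z : ℝ =>
    ENNReal.ofReal (√(Real.pi * c) * Real.exp (-(Real.pi ^ 2 * c) * z ^ 2))) x,
    ← ofReal_integral_eq_lintegral_ofReal hint (Eventually.of_forall fun z => by positivity),
    integral_const_mul, integral_gaussian, ← Real.sqrt_mul (by positivity)]
  have : Real.pi * c * (Real.pi / (Real.pi ^ 2 * c)) = 1 := by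
    field_simp
  rw [this]
  simp

theorem continuous_inverseCharFun {μ : Measure ℝ} [IsProbabilityMeasure μ]
    (hμ : Integrable (charFun μ)) : Continuous (inverseCharFun μ) := by
  rw [← fourier_charFun_eq_inverseCharFun]
  have hψ : Integrable fun v : ℝ => charFun μ (2 * Real.pi * v) :=
    hμ.comp_mul_left' (by positivity)
  exact VectorFourier.fourierIntegral_continuous Real.continuous_fourierChar
    (by exact continuous_inner) hψ

theorem integrable_inverseCharFun {μ : Measure ℝ} [IsProbabilityMeasure μ]
    (hμ : Integrable (charFun μ)) : Integrable (inverseCharFun μ) := by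
  refine ⟨(continuous_inverseCharFun hμ).aestronglyMeasurable, ?_⟩
  let k : ℕ → ℝ → ℝ → ℝ := fun n z x =>
    √(Real.pi * (n + 1)) * Real.exp (-(Real.pi ^ 2 * (n + 1)) * (z - x) ^ 2)
  have hk0 : ∀ n z x, 0 ≤ k n z x := fun n z x => by positivity
  have hkc : ∀ n, Continuous (Function.uncurry (k n)) := fun n => by
    simp only [k, Function.uncurry_def]; fun_prop
  have hkint : ∀ n z, Integrable (k n z) μ := by
    intro n z
    refine (integrable_const √(Real.pi * (n + 1))).mono'
      ((hkc n).comp (Continuous.prodMk_right z)).aestronglyMeasurable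
      (Eventually.of_forall fun x => ?_)
    rw [Real.norm_of_nonneg (hk0 n z x)]
    refine mul_le_of_le_one_right (by positivity) (Real.exp_le_one_iff.2 ?_)
    have : 0 ≤ Real.pi ^ 2 * (n + 1) * (z - x) ^ 2 := by positivity
    linarith
  have hlim : ∀ z, Tendsto (fun n => ‖((∫ x, k n z x ∂μ : ℝ) : ℂ)‖ₑ) atTop
      (𝓝 ‖inverseCharFun μ z‖ₑ) := fun z =>
    ((tendsto_inverseCharFun hμ z).comp
      (tendsto_atTop_add_const_right _ 1 tendsto_natCast_atTop_atTop)).enorm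
  have hen : ∀ n z, ‖((∫ x, k n z x ∂μ : ℝ) : ℂ)‖ₑ = ∫⁻ x, ENNReal.ofReal (k n z x) ∂μ := by
    intro n z
    rw [← ofReal_norm, Complex.norm_real, Real.norm_of_nonneg (integral_nonneg (hk0 n z)),
      ofReal_integral_eq_lintegral_ofReal (hkint n z) (Eventually.of_forall (hk0 n z))]
  -- Fatou's lemma: each mollification has total mass one by Tonelli.
  have hle : ∫⁻ z, ‖inverseCharFun μ z‖ₑ ≤ 1 := by
    calc ∫⁻ z, ‖inverseCharFun μ z‖ₑ
        = ∫⁻ z, liminf (fun n => ∫⁻ x, ENNReal.ofReal (k n z x) ∂μ) atTop := by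
          refine lintegral_congr fun z => ?_
          rw [← (hlim z).liminf_eq]
          simp only [hen]
      _ ≤ liminf (fun n => ∫⁻ z, ∫⁻ x, ENNReal.ofReal (k n z x) ∂μ) atTop :=
          lintegral_liminf_le fun n =>
            Measurable.lintegral_prod_right' (hkc n).measurable.ennreal_ofReal
      _ = liminf (fun _ : ℕ => (1 : ℝ≥0∞)) atTop := by
          congr 1
          ext n
          rw [lintegral_lintegral_swap (hkc n).measurable.ennreal_ofReal.aemeasurable]
          simp only [k, lintegral_gaussian_kernel_eq_one (show (0 : ℝ) < n + 1 by positivity)]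
          simp
      _ = 1 := by simp
  exact hle.trans_lt ENNReal.one_lt_top

/-- **Fourier inversion**: a probability measure with integrable characteristic function is
absolutely continuous, with a continuous density. -/
theorem eq_withDensity_inverseCharFun {μ : Measure ℝ} [IsProbabilityMeasure μ]
    (hμ : Integrable (charFun μ)) :
    μ = volume.withDensity fun z => ENNReal.ofReal (inverseCharFun μ z).re := by
  have hψ : Integrable fun v : ℝ => charFun μ (2 * Real.pi * v) :=
    hμ.comp_mul_left' (by positivity)
  have hψc : Continuous fun v : ℝ => charFun μ (2 * Real.pi * v) :=
    continuous_charFun.comp (continuous_const.mul continuous_id)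
  have hint := integrable_inverseCharFun hμ
  -- Both the characteristic function and its transform are integrable, so inversion recovers the
  -- former; measures with equal characteristic functions coincide.
  have hinv := hψc.fourierInv_fourier_eq hψ (by rwa [fourier_charFun_eq_inverseCharFun])
  rw [fourier_charFun_eq_inverseCharFun] at hinv
  have hm : Measurable fun z => ENNReal.ofReal (inverseCharFun μ z).re :=
    (Complex.measurable_re.comp (continuous_inverseCharFun hμ).measurable).ennreal_ofReal
  have : IsFiniteMeasure (volume.withDensity fun z => ENNReal.ofReal (inverseCharFun μ z).re) :=
    isFiniteMeasure_withDensity_ofReal hint.re.2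
  refine Measure.ext_of_charFun ?_
  ext t
  have h1 : charFun μ t = 𝓕⁻ (inverseCharFun μ) (t / (2 * Real.pi)) := by
    rw [hinv]
    congr 1
    field_simp
  rw [h1, Real.fourierInv_eq', charFun_apply_real,
    integral_withDensity_eq_integral_toReal_smul hm (by simp)]
  refine integral_congr_ae (Eventually.of_forall fun z => ?_)
  simp only
  rw [ENNReal.toReal_ofReal (inverseCharFun_nonneg hμ z).1, Complex.real_smul,
    (inverseCharFun_nonneg hμ z).2, smul_eq_mul, mul_comm]
  congr 2
  simp
  field_simp

theorem ae_eq_inverseCharFun {μ : Measure ℝ} [IsProbabilityMeasure μ]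
    (hμ : Integrable (charFun μ)) {f : ℝ → ℝ} (hf : Measurable f) (hf0 : ∀ z, 0 ≤ f z)
    (h : μ = volume.withDensity fun z => ENNReal.ofReal (f z)) :
    ∀ᵐ z, f z = (inverseCharFun μ z).re := by
  have hm : Measurable fun z => (inverseCharFun μ z).re :=
    Complex.measurable_re.comp (continuous_inverseCharFun hμ).measurable
  have h1 := (withDensity_eq_iff_of_sigmaFinite hf.ennreal_ofReal.aemeasurable
    hm.ennreal_ofReal.aemeasurable).1 (h.symm.trans (eq_withDensity_inverseCharFun hμ))
  filter_upwards [h1] with z hz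
  exact (ENNReal.ofReal_eq_ofReal_iff (hf0 z) (inverseCharFun_nonneg hμ z).1).1 hz

theorem norm_inverseCharFun_le (μ : Measure ℝ) (z : ℝ) :
    ‖inverseCharFun μ z‖ ≤ (2 * Real.pi)⁻¹ * ∫ ξ, ‖charFun μ ξ‖ := by
  rw [inverseCharFun, norm_mul]
  have h1 : ‖(2 * Real.pi : ℂ)⁻¹‖ = (2 * Real.pi)⁻¹ := by
    rw [norm_inv, norm_mul, Complex.norm_real, Real.norm_of_nonneg Real.pi_pos.le]
    simp
  rw [h1]
  refine mul_le_mul_of_nonneg_left ((norm_integral_le_integral_norm _).trans_eq ?_) (by positivity)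
  refine integral_congr_ae (Eventually.of_forall fun ξ => ?_)
  simp only
  rw [norm_mul, Complex.norm_exp]
  simp

/-- **Plancherel's identity** for densities with integrable characteristic functions. -/
theorem integral_mul_density_eq {μ ν : Measure ℝ} [IsProbabilityMeasure μ]
    [IsProbabilityMeasure ν] (hν : Integrable (charFun ν))
    {f g : ℝ → ℝ} (hf : Measurable f) (hf0 : ∀ z, 0 ≤ f z) (hg : Measurable g)
    (hg0 : ∀ z, 0 ≤ g z) (hμf : μ = volume.withDensity fun z => ENNReal.ofReal (f z))
    (hνg : ν = volume.withDensity fun z => ENNReal.ofReal (g z)) :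
    ((∫ z, f z * g z : ℝ) : ℂ) =
      (2 * Real.pi : ℂ)⁻¹ * ∫ ξ : ℝ, charFun μ (-ξ) * charFun ν ξ := by
  -- The continuous version of the second density is integrated against `μ`; Fubini then needs
  -- integrability of `charFun ν` alone.
  have h1 : ((∫ z, f z * g z : ℝ) : ℂ) = ∫ z, inverseCharFun ν z ∂μ := by
    rw [hμf, integral_withDensity_eq_integral_toReal_smul hf.ennreal_ofReal (by simp),
      ← integral_complex_ofReal]
    refine integral_congr_ae ?_
    filter_upwards [ae_eq_inverseCharFun hν hg hg0 hνg] with z hz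
    rw [ENNReal.toReal_ofReal (hf0 z), Complex.real_smul, Complex.ofReal_mul, hz,
      (inverseCharFun_nonneg hν z).2]
  rw [h1]
  simp only [inverseCharFun]
  rw [integral_const_mul, integral_integral_swap]
  · congr 1
    refine integral_congr_ae (Eventually.of_forall fun ξ => ?_)
    simp only
    rw [integral_mul_const, charFun_apply_real (μ := μ)]
    congr 1
    refine integral_congr_ae (Eventually.of_forall fun z => ?_)
    simp only
    congr 1
    push_cast
    ring
  · have hg2 : Integrable (fun p : ℝ × ℝ => ‖charFun ν p.2‖) (μ.prod volume) :=
      hν.norm.comp_snd μ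
    have hc : Continuous (charFun ν) := continuous_charFun
    refine hg2.mono' ?_ (Eventually.of_forall fun p => ?_)
    · simp only [Function.uncurry_def]
      exact Continuous.aestronglyMeasurable (by fun_prop)
    · simp only [Function.uncurry]
      rw [norm_mul, Complex.norm_exp]
      simp

end FourierInversion

/-! ### Lévy exponents and transition densities -/

section Levy

variable {Ω₀ : Type*} [MeasurableSpace Ω₀] {P₀ : Measure Ω₀}
  {X : ℝ≥0 → Ω₀ → ℝ} {Ψ : ℝ → ℂ}

theorem IsLevyProcess.isProbabilityMeasure_map [IsProbabilityMeasure P₀]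
    (hX : IsLevyProcess X P₀) (s : ℝ≥0) (x : ℝ) :
    IsProbabilityMeasure (P₀.map fun ω => x + X s ω) :=
  Measure.isProbabilityMeasure_map ((hX.measurable s).const_add x).aemeasurable

theorem charFun_map_add (hX : IsLevyProcess X P₀) (hΨ : IsCharExponent X P₀ Ψ) (s : ℝ≥0)
    (x ξ : ℝ) : charFun (P₀.map fun ω => x + X s ω) ξ =
      Complex.exp (Complex.I * x * ξ) * Complex.exp (-((s : ℝ) : ℂ) * Ψ ξ) := by
  rw [charFun_apply_real, integral_map ((hX.measurable s).const_add x).aemeasurable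
    (by fun_prop), ← hΨ s ξ, ← integral_const_mul]
  refine integral_congr_ae (Eventually.of_forall fun ω => ?_)
  simp only
  rw [← Complex.exp_add]
  congr 1
  push_cast
  ring

theorem norm_charFun_map_add (hX : IsLevyProcess X P₀) (hΨ : IsCharExponent X P₀ Ψ) (s : ℝ≥0)
    (x ξ : ℝ) : ‖charFun (P₀.map fun ω => x + X s ω) ξ‖ = Real.exp (-s * (Ψ ξ).re) := by
  rw [charFun_map_add hX hΨ, norm_mul, Complex.norm_exp, Complex.norm_exp]
  simp

theorem IsCharExponent.re_nonneg [IsProbabilityMeasure P₀]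
    (hΨ : IsCharExponent X P₀ Ψ) (ξ : ℝ) : 0 ≤ (Ψ ξ).re := by
  have h1 : ‖∫ ω, Complex.exp (Complex.I * (ξ : ℂ) * (X 1 ω : ℂ)) ∂P₀‖ ≤ 1 := by
    refine (norm_integral_le_of_norm_le_const (C := 1) (Eventually.of_forall fun ω => ?_)).trans ?_
    · rw [Complex.norm_exp]; simp
    · simp
  rw [hΨ 1 ξ, Complex.norm_exp, Real.exp_le_one_iff] at h1
  simpa using h1

/-- A single time determines `Ψ` only modulo a period of the exponential. Small times remove the
ambiguity: $\Psi=\lim_n (n+1)(1-e^{-\Psi/(n+1)})$, a limit of measurable functions. -/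
theorem IsCharExponent.measurable [IsProbabilityMeasure P₀]
    (hX : IsLevyProcess X P₀) (hΨ : IsCharExponent X P₀ Ψ) :
    Measurable Ψ := by
  have hm : ∀ s : ℝ≥0, Measurable fun ξ => Complex.exp (-((s : ℝ) : ℂ) * Ψ ξ) := by
    intro s
    have := hX.isProbabilityMeasure_map s 0
    have h : Continuous (charFun (P₀.map fun ω => 0 + X s ω)) := continuous_charFun
    have heq : charFun (P₀.map fun ω => 0 + X s ω) =
        fun ξ => Complex.exp (-((s : ℝ) : ℂ) * Ψ ξ) := by
      ext ξ
      rw [charFun_map_add hX hΨ]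
      simp
    rw [← heq]
    exact h.measurable
  refine measurable_of_tendsto_metrizable (f := fun (n : ℕ) ξ =>
    ((n : ℂ) + 1) * (1 - Complex.exp (-((((n : ℝ≥0) + 1)⁻¹ : ℝ≥0) : ℝ) * Ψ ξ)))
    (fun n => ((hm _).const_sub 1).const_mul _) ?_
  rw [tendsto_pi_nhds]
  intro ξ
  have hd : HasDerivAt (fun r : ℝ => Complex.exp (-(r : ℂ) * Ψ ξ)) (-Ψ ξ) 0 := by
    have h1 : HasDerivAt (fun r : ℝ => -(r : ℂ) * Ψ ξ) (-1 * Ψ ξ) 0 :=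
      (Complex.ofRealCLM.hasDerivAt (x := (0 : ℝ))).neg.mul_const _
    simpa using h1.cexp
  have h2 := hasDerivAt_iff_tendsto_slope_zero.1 hd
  have h3 : Tendsto (fun n : ℕ => ((n : ℝ) + 1)⁻¹) atTop (𝓝[≠] 0) := by
    refine tendsto_nhdsWithin_iff.2 ⟨?_, Eventually.of_forall fun n => ?_⟩
    · simpa using tendsto_one_div_add_atTop_nhds_zero_nat (𝕜 := ℝ)
    · exact inv_ne_zero (by positivity)
  have h4 := (h2.comp h3).neg
  rw [neg_neg] at h4
  refine h4.congr fun n => ?_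
  simp only [Function.comp_apply, inv_inv, zero_add, Complex.real_smul]
  push_cast
  simp
  ring

theorem exists_bound_pow_mul_exp (hlog : Tendsto (fun ξ : ℝ => (Ψ ξ).re / Real.log |ξ|)
    (comap (fun ξ : ℝ => |ξ|) atTop) atTop) (h0 : ∀ ξ, 0 ≤ (Ψ ξ).re) (k : ℕ) {t : ℝ}
    (ht : 0 < t) : ∃ C, ∀ ξ, |ξ| ^ k * Real.exp (-t * (Ψ ξ).re) ≤ C := by
  have h1 := hlog.eventually_ge_atTop (k / t)
  rw [eventually_comap] at h1
  obtain ⟨R, hR⟩ := eventually_atTop.1 h1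
  -- Beyond `R` one has $t\,\mathrm{Re}\Psi\ge k\log|\xi|$, so the product is at most 1; the
  -- threshold 2 keeps the logarithm positive.
  refine ⟨max 1 (max R 2 ^ k), fun ξ => ?_⟩
  rcases le_total |ξ| (max R 2) with h | h
  · refine le_max_of_le_right ?_
    have he : Real.exp (-t * (Ψ ξ).re) ≤ 1 := by
      rw [Real.exp_le_one_iff]
      nlinarith [h0 ξ]
    exact (mul_le_of_le_one_right (by positivity) he).trans (pow_le_pow_left₀ (abs_nonneg _) h k)
  · refine le_max_of_le_left ?_
    have h2 : 2 ≤ |ξ| := (le_max_right _ _).trans h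
    have hl : 0 < Real.log |ξ| := Real.log_pos (by linarith)
    have h3 := hR |ξ| ((le_max_left _ _).trans h) ξ rfl
    rw [le_div_iff₀ hl, div_mul_eq_mul_div, div_le_iff₀ ht] at h3
    have h4 : |ξ| ^ k = Real.exp (k * Real.log |ξ|) := by
      rw [← Real.log_pow, Real.exp_log (by positivity)]
    rw [h4, ← Real.exp_add, Real.exp_le_one_iff]
    linarith

theorem integrable_pow_mul_exp [IsProbabilityMeasure P₀]
    (hX : IsLevyProcess X P₀) (hΨ : IsCharExponent X P₀ Ψ)
    (hlog : Tendsto (fun ξ : ℝ => (Ψ ξ).re / Real.log |ξ|)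
      (comap (fun ξ : ℝ => |ξ|) atTop) atTop) (k : ℕ) {t : ℝ} (ht : 0 < t) :
    Integrable fun ξ : ℝ => ξ ^ k * Real.exp (-t * (Ψ ξ).re) := by
  -- Bounding the powers `k` and `k + 2` together gives the integrable majorant $(C+C')/(1+\xi^2)$.
  obtain ⟨C, hC⟩ := exists_bound_pow_mul_exp hlog hΨ.re_nonneg k ht
  obtain ⟨C', hC'⟩ := exists_bound_pow_mul_exp hlog hΨ.re_nonneg (k + 2) ht
  have hm := hΨ.measurable hX
  refine (integrable_inv_one_add_sq.const_mul (C + C')).mono' (by fun_prop)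
    (Eventually.of_forall fun ξ => ?_)
  rw [← div_eq_mul_inv, le_div_iff₀ (by positivity), norm_mul, norm_pow, Real.norm_eq_abs,
    Real.norm_of_nonneg (Real.exp_pos _).le]
  refine le_trans (le_of_eq ?_) (add_le_add (hC ξ) (hC' ξ))
  rw [← sq_abs ξ]
  ring

theorem integrable_charFun_map_add [IsProbabilityMeasure P₀]
    (hX : IsLevyProcess X P₀) (hΨ : IsCharExponent X P₀ Ψ)
    (hlog : Tendsto (fun ξ : ℝ => (Ψ ξ).re / Real.log |ξ|)
      (comap (fun ξ : ℝ => |ξ|) atTop) atTop) {s : ℝ≥0} (hs : 0 < s) (x : ℝ) :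
    Integrable (charFun (P₀.map fun ω => x + X s ω)) := by
  have := hX.isProbabilityMeasure_map s x
  have h := integrable_pow_mul_exp hX hΨ hlog 0 (t := s) (by exact_mod_cast hs)
  simp only [pow_zero, one_mul] at h
  exact h.mono' (continuous_charFun.aestronglyMeasurable)
    (Eventually.of_forall fun ξ => (norm_charFun_map_add hX hΨ s x ξ).le)

/-- Lévy processes whose exponent grows faster than the logarithm have transition densities. -/
theorem exists_isTransitionDensity [IsProbabilityMeasure P₀]
    (hX : IsLevyProcess X P₀) (hΨ : IsCharExponent X P₀ Ψ)
    (hlog : Tendsto (fun ξ : ℝ => (Ψ ξ).re / Real.log |ξ|)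
      (comap (fun ξ : ℝ => |ξ|) atTop) atTop) : ∃ p, IsTransitionDensity X P₀ p := by
  refine ⟨fun s x y => (inverseCharFun (P₀.map fun ω => x + X s.toNNReal ω) y).re, ?_, ?_, ?_⟩
  · simp only [inverseCharFun, charFun_map_add hX hΨ]
    have hm := hΨ.measurable hX
    have h1 : Measurable fun z : (ℝ × ℝ × ℝ) × ℝ =>
        Complex.exp (-(Complex.I * z.2 * z.1.2.2)) * (Complex.exp (Complex.I * z.1.2.1 * z.2) *
          Complex.exp (-((z.1.1.toNNReal : ℝ) : ℂ) * Ψ z.2)) := by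
      have h2 : Measurable fun z : (ℝ × ℝ × ℝ) × ℝ => ((z.1.1.toNNReal : ℝ) : ℂ) := by fun_prop
      fun_prop
    have h3 := h1.stronglyMeasurable.integral_prod_right' (ν := volume)
    exact Complex.measurable_re.comp (h3.measurable.const_mul _)
  · intro s x y hs
    have := hX.isProbabilityMeasure_map s.toNNReal x
    exact (inverseCharFun_nonneg
      (integrable_charFun_map_add hX hΨ hlog (Real.toNNReal_pos.2 hs) x) y).1
  · intro s x hs
    have := hX.isProbabilityMeasure_map s x
    simp only [Real.toNNReal_coe]
    exact eq_withDensity_inverseCharFun (integrable_charFun_map_add hX hΨ hlog hs x)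

variable {p : ℝ → ℝ → ℝ → ℝ}

theorem IsTransitionDensity.measurable_apply (hp : IsTransitionDensity X P₀ p) (s x : ℝ) :
    Measurable (p s x) :=
  hp.measurable.comp (measurable_prodMk_left.comp measurable_prodMk_left)

/-- Inversion bounds the density by the $L^1$ norm of $e^{-s\,\mathrm{Re}\Psi}$, which decreases in
$s$; hence one constant for all $s\ge t$. -/
theorem IsTransitionDensity.ae_le [IsProbabilityMeasure P₀]
    (hp : IsTransitionDensity X P₀ p) (hX : IsLevyProcess X P₀)
    (hΨ : IsCharExponent X P₀ Ψ)
    (hlog : Tendsto (fun ξ : ℝ => (Ψ ξ).re / Real.log |ξ|)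
      (comap (fun ξ : ℝ => |ξ|) atTop) atTop) {t s : ℝ} (ht : 0 < t) (hts : t ≤ s) (x : ℝ) :
    ∀ᵐ y, p s x y ≤ (2 * Real.pi)⁻¹ * ∫ ξ, Real.exp (-t * (Ψ ξ).re) := by
  lift s to ℝ≥0 using ht.le.trans hts
  have hs : 0 < s := by exact_mod_cast ht.trans_le hts
  have := hX.isProbabilityMeasure_map s x
  have hint := integrable_charFun_map_add hX hΨ hlog hs x
  filter_upwards [ae_eq_inverseCharFun hint (hp.measurable_apply s x)
    (fun y => hp.nonneg s x y (by exact_mod_cast hs)) (hp.density s x hs)] with y hy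
  rw [hy]
  refine (Complex.re_le_norm _).trans ((norm_inverseCharFun_le _ _).trans ?_)
  refine mul_le_mul_of_nonneg_left ?_ (by positivity)
  simp only [norm_charFun_map_add hX hΨ]
  have h1 := integrable_pow_mul_exp hX hΨ hlog 0 (t := s) (by exact_mod_cast hs)
  have h2 := integrable_pow_mul_exp hX hΨ hlog 0 ht
  simp only [pow_zero, one_mul] at h1 h2
  refine integral_mono h1 h2 fun ξ => Real.exp_le_exp.2 ?_
  nlinarith [hΨ.re_nonneg ξ]

/-- Plancherel: conjugating one characteristic function cancels $\mathrm{Im}\,\Psi$, leaving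
$e^{-2s\,\mathrm{Re}\Psi(\xi)}e^{-i(x-x')\xi}$, whose real part is kept. -/
theorem IsTransitionDensity.integral_mul [IsProbabilityMeasure P₀]
    (hp : IsTransitionDensity X P₀ p)
    (hX : IsLevyProcess X P₀) (hΨ : IsCharExponent X P₀ Ψ)
    (hlog : Tendsto (fun ξ : ℝ => (Ψ ξ).re / Real.log |ξ|)
      (comap (fun ξ : ℝ => |ξ|) atTop) atTop) {s : ℝ} (hs : 0 < s) (x x' : ℝ) :
    ∫ y, p s x y * p s x' y =
      (2 * Real.pi)⁻¹ * ∫ ξ, Real.exp (-s * (Ψ ξ).re) ^ 2 * Real.cos ((x - x') * ξ) := by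
  lift s to ℝ≥0 using hs.le
  have hs' : 0 < s := by exact_mod_cast hs
  have := hX.isProbabilityMeasure_map s x
  have := hX.isProbabilityMeasure_map s x'
  have hint := integrable_charFun_map_add hX hΨ hlog hs' x'
  have key := integral_mul_density_eq hint (hp.measurable_apply s x)
    (fun y => hp.nonneg s x y hs) (hp.measurable_apply s x') (fun y => hp.nonneg s x' y hs)
    (hp.density s x hs') (hp.density s x' hs')
  have hprod : Integrable fun ξ => charFun (P₀.map fun ω => x + X s ω) (-ξ) *
      charFun (P₀.map fun ω => x' + X s ω) ξ := by
    refine hint.norm.mono' ?_ (Eventually.of_forall fun ξ => ?_)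
    · have h1 : Continuous (charFun (P₀.map fun ω => x + X s ω)) := continuous_charFun
      have h2 : Continuous (charFun (P₀.map fun ω => x' + X s ω)) := continuous_charFun
      exact ((h1.comp continuous_neg).mul h2).aestronglyMeasurable
    · rw [norm_mul]
      exact mul_le_of_le_one_left (norm_nonneg _) (norm_charFun_le_one _)
  have hre := congrArg Complex.re key
  have hpi : (2 * Real.pi : ℂ)⁻¹ = (((2 * Real.pi)⁻¹ : ℝ) : ℂ) := by push_cast; rfl
  rw [Complex.ofReal_re, hpi, Complex.re_ofReal_mul] at hre
  rw [hre]
  congr 1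
  refine (integral_re hprod).symm.trans (integral_congr_ae (Eventually.of_forall fun ξ => ?_))
  change (charFun _ (-ξ) * charFun _ ξ).re =
    Real.exp (-s * (Ψ ξ).re) ^ 2 * Real.cos ((x - x') * ξ)
  rw [charFun_neg, charFun_map_add hX hΨ, charFun_map_add hX hΨ, map_mul (starRingEnd ℂ), ← Complex.exp_conj,
    ← Complex.exp_conj, ← Complex.exp_add, ← Complex.exp_add, ← Complex.exp_add]
  have harg : (starRingEnd ℂ) (Complex.I * x * ξ) + (starRingEnd ℂ) (-((s : ℝ) : ℂ) * Ψ ξ) +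
      (Complex.I * x' * ξ + -((s : ℝ) : ℂ) * Ψ ξ) =
      ((-(2 * s * (Ψ ξ).re) : ℝ) : ℂ) + ((-((x - x') * ξ) : ℝ) : ℂ) * Complex.I := by
    apply Complex.ext
    · simp; ring
    · simp; ring
  rw [harg, Complex.exp_add, ← Complex.ofReal_exp, Complex.re_ofReal_mul,
    Complex.exp_ofReal_mul_I_re, Real.cos_neg, ← Real.exp_nat_mul]
  congr 2
  push_cast
  ring

end Levy

/-! ### Square integrability and spectral covariance of the tail field -/

section TailField

variable {Ω₀ : Type*} [MeasurableSpace Ω₀] {P₀ : Measure Ω₀} {X : ℝ≥0 → Ω₀ → ℝ} {Ψ : ℝ → ℂ}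
  {p : ℝ → ℝ → ℝ → ℝ} {t α : ℝ}

theorem IsTransitionDensity.measurable_tailIntegrand (hp : IsTransitionDensity X P₀ p)
    (α t x : ℝ) : Measurable (tailIntegrand p α t x) := by
  have h1 : Measurable fun q : ℝ × ℝ => Real.exp (-α * q.1 / 2) * p q.1 x q.2 := by
    have h2 : Measurable fun q : ℝ × ℝ => p q.1 x q.2 :=
      hp.measurable.comp (measurable_fst.prodMk (measurable_const.prodMk measurable_snd))
    fun_prop
  exact h1.indicator (s := Prod.fst ⁻¹' Set.Ioi t) (measurable_fst measurableSet_Ioi)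

theorem integrableOn_exp_neg_mul_Ioi (hα : 0 < α) (t : ℝ) :
    IntegrableOn (fun s => Real.exp (-α * s)) (Set.Ioi t) :=
  integrableOn_exp_mul_Ioi (neg_neg_of_pos hα) t

/-- The integrand of the tail field is square integrable. -/
theorem IsTransitionDensity.memLp_tailIntegrand [IsProbabilityMeasure P₀]
    (hp : IsTransitionDensity X P₀ p) (hX : IsLevyProcess X P₀) (hΨ : IsCharExponent X P₀ Ψ)
    (hlog : Tendsto (fun ξ : ℝ => (Ψ ξ).re / Real.log |ξ|)
      (comap (fun ξ : ℝ => |ξ|) atTop) atTop) (ht : 0 < t) (hα : 0 < α) (x : ℝ) :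
    MemLp (tailIntegrand p α t x) 2 spaceTimeMeasure := by
  have hm := hp.measurable_tailIntegrand α t x
  rw [memLp_two_iff_integrable_sq hm.aestronglyMeasurable]
  refine ⟨(hm.pow_const 2).aestronglyMeasurable, ?_⟩
  rw [HasFiniteIntegral, spaceTimeMeasure, lintegral_prod _ (hm.pow_const 2).enorm.aemeasurable]
  -- With `C` the uniform bound on the density, $\int p_s^2\,dy\le C\int p_s\,dy=C$, and $e^{-\alpha
  -- s}$ makes the time integral finite.
  set C : ℝ := (2 * Real.pi)⁻¹ * ∫ ξ, Real.exp (-t * (Ψ ξ).re) with hC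
  have hC0 : 0 ≤ C := mul_nonneg (by positivity) (integral_nonneg fun ξ => (Real.exp_pos _).le)
  have hbound : ∀ s, ∫⁻ y, ‖tailIntegrand p α t x (s, y) ^ 2‖ₑ ≤
      (Set.Ioi t).indicator (fun s => ENNReal.ofReal (C * Real.exp (-α * s))) s := by
    intro s
    by_cases hs : s ∈ Set.Ioi t
    · have hs0 : 0 < s := ht.trans hs
      rw [Set.indicator_of_mem hs]
      have hone : ∫⁻ y, ENNReal.ofReal (p s x y) = 1 := by
        lift s to ℝ≥0 using hs0.le
        have h1 := hX.isProbabilityMeasure_map s x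
        have h2 := hp.density s x (by exact_mod_cast hs0)
        have h3 := h1.measure_univ
        rwa [h2, withDensity_apply _ MeasurableSet.univ, setLIntegral_univ] at h3
      calc ∫⁻ y, ‖tailIntegrand p α t x (s, y) ^ 2‖ₑ
          ≤ ∫⁻ y, ENNReal.ofReal (C * Real.exp (-α * s)) * ENNReal.ofReal (p s x y) := by
            refine lintegral_mono_ae ?_
            filter_upwards [hp.ae_le hX hΨ hlog ht (le_of_lt hs) x] with y hy
            have hp0 := hp.nonneg s x y hs0
            rw [← ENNReal.ofReal_mul (by positivity), Real.enorm_of_nonneg (sq_nonneg _)]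
            refine ENNReal.ofReal_le_ofReal ?_
            have he : Real.exp (-α * s / 2) ^ 2 = Real.exp (-α * s) := by
              rw [← Real.exp_nat_mul]; congr 1; push_cast; ring
            rw [tailIntegrand, Set.indicator_of_mem hs, mul_pow, he]
            calc Real.exp (-α * s) * p s x y ^ 2
                = Real.exp (-α * s) * (p s x y * p s x y) := by ring
              _ ≤ Real.exp (-α * s) * (C * p s x y) := by gcongr
              _ = C * Real.exp (-α * s) * p s x y := by ring
        _ = _ := by
            rw [lintegral_const_mul _ (hp.measurable_apply s x).ennreal_ofReal, hone, mul_one]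
    · rw [Set.indicator_of_notMem hs]
      simp [tailIntegrand, hs]
  calc _ ≤ ∫⁻ s in Set.Ici (0 : ℝ),
        (Set.Ioi t).indicator (fun s => ENNReal.ofReal (C * Real.exp (-α * s))) s :=
        lintegral_mono hbound
    _ ≤ ∫⁻ s, (Set.Ioi t).indicator (fun s => ENNReal.ofReal (C * Real.exp (-α * s))) s :=
        setLIntegral_le_lintegral _ _
    _ = ∫⁻ s in Set.Ioi t, ENNReal.ofReal (C * Real.exp (-α * s)) :=
        lintegral_indicator measurableSet_Ioi _
    _ < ∞ := ((integrableOn_exp_neg_mul_Ioi hα t).const_mul C).lintegral_lt_top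

/-- The amplitude of the spectral representation of the tail field. -/
noncomputable def spectralAmplitude (Ψ : ℝ → ℂ) (α : ℝ) (z : ℝ × ℝ) : ℝ :=
  (√(2 * Real.pi))⁻¹ * Real.exp (-α * z.1 / 2) * Real.exp (-z.1 * (Ψ z.2).re)

/-- On $s>t$, replacing $e^{-s\,\mathrm{Re}\Psi}$ by $e^{-t\,\mathrm{Re}\Psi}$ gives a majorant that
is a product of functions of $s$ and $\xi$. -/
theorem memLp_pow_mul_spectralAmplitude [IsProbabilityMeasure P₀] (hX : IsLevyProcess X P₀)
    (hΨ : IsCharExponent X P₀ Ψ) (hlog : Tendsto (fun ξ : ℝ => (Ψ ξ).re / Real.log |ξ|)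
      (comap (fun ξ : ℝ => |ξ|) atTop) atTop) (ht : 0 < t) (hα : 0 < α) (k : ℕ) :
    MemLp (fun z : ℝ × ℝ => z.2 ^ k * spectralAmplitude Ψ α z) 2
      ((volume.restrict (Set.Ioi t)).prod volume) := by
  have hm := hΨ.measurable hX
  have hg : MemLp (fun z : ℝ × ℝ => ((√(2 * Real.pi))⁻¹ * Real.exp (-α * z.1 / 2)) *
      (z.2 ^ k * Real.exp (-t * (Ψ z.2).re))) 2 ((volume.restrict (Set.Ioi t)).prod volume) := by
    rw [memLp_two_iff_integrable_sq (by fun_prop)]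
    have h1 := (integrableOn_exp_neg_mul_Ioi hα t).const_mul ((√(2 * Real.pi))⁻¹ ^ 2)
    have h2 := integrable_pow_mul_exp hX hΨ hlog (k * 2) (t := 2 * t) (by positivity)
    refine (Integrable.mul_prod h1 h2).congr (Eventually.of_forall fun z => ?_)
    have h3 : Real.exp (-α * z.1) = Real.exp (-α * z.1 / 2) ^ 2 := by
      rw [← Real.exp_nat_mul]; congr 1; push_cast; ring
    have h4 : Real.exp (-(2 * t) * (Ψ z.2).re) = Real.exp (-t * (Ψ z.2).re) ^ 2 := by
      rw [← Real.exp_nat_mul]; congr 1; push_cast; ring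
    simp only
    rw [h3, h4]
    ring
  refine hg.of_le ?_ ?_
  · unfold spectralAmplitude
    exact Measurable.aestronglyMeasurable (by fun_prop)
  · have hae : ∀ᵐ z : ℝ × ℝ ∂(volume.restrict (Set.Ioi t)).prod volume, z.1 ∈ Set.Ioi t :=
      Measure.quasiMeasurePreserving_fst.ae (ae_restrict_mem measurableSet_Ioi)
    filter_upwards [hae] with z hz
    have he : Real.exp (-z.1 * (Ψ z.2).re) ≤ Real.exp (-t * (Ψ z.2).re) :=
      Real.exp_le_exp.2 (by nlinarith [hΨ.re_nonneg z.2, Set.mem_Ioi.1 hz])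
    simp only [spectralAmplitude, norm_mul, Real.norm_eq_abs, Real.abs_exp]
    calc _ = |(√(2 * Real.pi))⁻¹| * Real.exp (-α * z.1 / 2) *
          (|z.2 ^ k| * Real.exp (-z.1 * (Ψ z.2).re)) := by ring
      _ ≤ _ := by gcongr

/-- The spectral representation of the covariance of the tail field. -/
theorem IsTransitionDensity.integral_tailIntegrand_mul [IsProbabilityMeasure P₀]
    (hp : IsTransitionDensity X P₀ p) (hX : IsLevyProcess X P₀) (hΨ : IsCharExponent X P₀ Ψ)
    (hlog : Tendsto (fun ξ : ℝ => (Ψ ξ).re / Real.log |ξ|)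
      (comap (fun ξ : ℝ => |ξ|) atTop) atTop) (ht : 0 < t) (hα : 0 < α) (x x' : ℝ) :
    ∫ q, tailIntegrand p α t x q * tailIntegrand p α t x' q ∂spaceTimeMeasure =
      ∫ z : ℝ × ℝ, spectralAmplitude Ψ α z ^ 2 * Real.cos ((x - x') * z.2)
        ∂(volume.restrict (Set.Ioi t)).prod volume := by
  have hint1 : Integrable (fun q => tailIntegrand p α t x q * tailIntegrand p α t x' q)
      spaceTimeMeasure := (hp.memLp_tailIntegrand hX hΨ hlog ht hα x).integrable_mul
    (hp.memLp_tailIntegrand hX hΨ hlog ht hα x')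
  have hint2 : Integrable (fun z : ℝ × ℝ =>
      spectralAmplitude Ψ α z ^ 2 * Real.cos ((x - x') * z.2))
      ((volume.restrict (Set.Ioi t)).prod volume) := by
    have h1 := memLp_pow_mul_spectralAmplitude hX hΨ hlog ht hα 0
    simp only [pow_zero, one_mul] at h1
    exact h1.integrable_sq.mul_of_top_left (memLp_top_of_bound (by fun_prop) 1
      (Eventually.of_forall fun z => Real.abs_cos_le_one _))
  rw [integral_prod _ hint2]
  rw [spaceTimeMeasure] at hint1 ⊢
  rw [integral_prod _ hint1]
  have hind : ∀ s, ∫ y, tailIntegrand p α t x (s, y) * tailIntegrand p α t x' (s, y) =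
      (Set.Ioi t).indicator (fun s => ∫ ξ : ℝ, spectralAmplitude Ψ α (s, ξ) ^ 2 *
        Real.cos ((x - x') * ξ)) s := by
    intro s
    by_cases hs : s ∈ Set.Ioi t
    · have h1 : ∀ y, tailIntegrand p α t x (s, y) * tailIntegrand p α t x' (s, y) =
          Real.exp (-α * s / 2) ^ 2 * (p s x y * p s x' y) := by
        intro y
        simp only [tailIntegrand, Set.indicator_of_mem hs]
        ring
      have h2 : ∀ ξ, spectralAmplitude Ψ α (s, ξ) ^ 2 * Real.cos ((x - x') * ξ) =
          Real.exp (-α * s / 2) ^ 2 * ((2 * Real.pi)⁻¹ *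
            (Real.exp (-s * (Ψ ξ).re) ^ 2 * Real.cos ((x - x') * ξ))) := by
        intro ξ
        simp only [spectralAmplitude, mul_pow, inv_pow]
        rw [Real.sq_sqrt (by positivity)]
        ring
      simp only [h1, h2, Set.indicator_of_mem hs]
      rw [integral_const_mul, integral_const_mul, integral_const_mul,
        hp.integral_mul hX hΨ hlog (ht.trans hs)]
    · simp [tailIntegrand, hs]
  simp only [hind]
  rw [integral_indicator measurableSet_Ioi, Measure.restrict_restrict measurableSet_Ioi,
    Set.inter_eq_left.2 (Set.Ioi_subset_Ici ht.le)]

end TailField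

/-! ### Densities, Wiener integrals and the smooth modification -/

theorem proposition4p1
    {Ω₀ : Type*} [MeasurableSpace Ω₀] (P₀ : Measure Ω₀) [IsProbabilityMeasure P₀]
    (X : ℝ≥0 → Ω₀ → ℝ) (hX : IsLevyProcess X P₀)
    (Ψ : ℝ → ℂ) (hΨ : IsCharExponent X P₀ Ψ)
    (hDalang : DalangCondition Ψ)
    (hlog : Tendsto (fun ξ : ℝ => (Ψ ξ).re / Real.log |ξ|) (comap (fun ξ : ℝ => |ξ|) atTop) atTop)
    {Ω : Type*} [MeasurableSpace Ω] (P : Measure Ω) [IsProbabilityMeasure P]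
    (W : Set (ℝ × ℝ) → Ω → ℝ) (hW : IsWhiteNoise spaceTimeMeasure W P) :
    (∃ p : ℝ → ℝ → ℝ → ℝ, IsTransitionDensity X P₀ p) ∧
    ∀ p : ℝ → ℝ → ℝ → ℝ, IsTransitionDensity X P₀ p →
      ∀ t α : ℝ, 0 < t → 0 < α →
        (∃ S : ℝ → Ω → ℝ, IsTailField W P p α t S) ∧
        ∀ S : ℝ → Ω → ℝ, IsTailField W P p α t S →
          ∃ S' : ℝ → Ω → ℝ, IsModification P S' S ∧
            ∀ ω, ContDiff ℝ (⊤ : ℕ∞) (fun x => S' x ω) := by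
  refine ⟨exists_isTransitionDensity hX hΨ hlog, fun p hp t α ht hα => ⟨?_, fun S hS => ?_⟩⟩
  · choose S hS using fun x =>
      hW.exists_isWienerIntegral (hp.memLp_tailIntegrand hX hΨ hlog ht hα x)
    exact ⟨S, hS⟩
  · obtain ⟨e, he, hinner⟩ := exists_smooth_spectral_curve measurable_snd
      fun k => memLp_pow_mul_spectralAmplitude hX hΨ hlog ht hα k
    -- `T` sends the spectral curve to the field, so the curves `T (e k x)` are its successive
    -- mean-square derivatives.
    obtain ⟨T, hT⟩ := exists_clm_of_inner_eq (e 0) (fun x => (hS x).memLp.toLp) fun x x' => by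
      rw [IsWienerIntegral.inner_toLp hW (hS x) (hS x'), hinner,
        hp.integral_tailIntegrand_mul hX hΨ hlog ht hα]
    obtain ⟨S', hm, hae, hsmooth⟩ := exists_smooth_version (fun k x => T (e k x))
      fun k x => T.hasFDerivAt.comp_hasDerivAt x (he k x)
    refine ⟨S', ⟨hm, fun x => (hae x).trans ?_⟩, hsmooth⟩
    simp only [hT]
    exact (hS x).memLp.coeFn_toLp
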